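/- Consider a Markov decision process with finite state space $\mathcal X$, finite action space $\mathcal A$, transition kernel $P(x'\mid a,x)$, reward $r(x,a)$ and discount factor $\gamma\in(0,1)$, a policy $\pi(a\mid x)$, and a feature map $\phi:\mathcal X\to\mathbb R^d$. Let $P_\pi(x'\mid x)=\sum_a P(x'\mid a,x)\pi(a\mid x)$, and let $(x_n,a_n)_{n\ge 1}$ be the trajectory generated by $\pi$ and $P$, with $r_n=r(x_n,a_n)$ and $\phi_n=\phi(x_n)$. Assume: (i) $P_\pi$ is irreducible and aperiodic, with unique stationary distribution $\mu_\pi$, $\mu_\pi(x)>0$ for all $x$, and $x_1\sim\mu_\pi$; (ii) $|r_n|\le r_{\max}$ almost surely for all $n$, where $r_{\max}>0$; (iii) $\|\phi_n\|\le 1$ almost surely for all $n$; (iv) the matrix $\Phi$ with rows $\phi(x)^\top$ has full column rank. Let $\lambda_{\min}$ be the smallest eigenvalue of $\Sigma=\sum_x\mu_\pi(x)\phi(x)\phi(x)^\top$. Then there are $m>0$ and $\rho\in(0,1)$ such that $$\sup_x d_{\mathrm{TV}}\bigl(P_\pi^n(\cdot\mid x),\mu_\pi\bigr)\le m\rho^n\quad\text{for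 all } n\ge 0,\qquad (\ast)$$ where $P_\pi^n$ is the $n$-step kernel, and there is a unique $w_*\in\mathbb R^d$ with $\mathbb E_\infty(\phi_n\phi_n^\top-\gamma\phi_n\phi_{n+1}^\top)w_*=\mathbb E_\infty(r_n\phi_n)$, where $\mathbb E_\infty$ is the steady-state expectation. Fix any $m>0$, $\rho\in(0,1)$ satisfying $(\ast)$ and let $\tau_\alpha=\min\{n\ge 0: m\rho^n\le\alpha\}$. Let $\alpha>0$ be a constant step size with $2\alpha(1-\gamma)\lambda_{\min}<1+\alpha$, let $R\ge\|w_*\|$, let $w_1\in\mathbb R^d$ be deterministic, and let $(w_n)$ be the projected implicit TD(0) iterates $$w_{n+1}=\Pi_R\Bigl\{w_n+\tfrac{\alpha}{1+\alpha\|\phi_n\|^2}\bigl(r_n+\gamma\phi_{n+1}^\top w_n-\phi_n^\top w_n\bigr)\phi_n\Bigr\},$$ where $\Pi_R$ is the projection onto the Euclidean ball $\{\|w\|\le R\}$. Put $G=r_{\max}+2R$. Then for every $N$ $$\mathbb E\|w_{N+1}-w_*\|^2\le e^{-\frac{2\alpha(1-\gamma)\lambda_{\min}}{1+\alpha}N}\|w_1-w_*\|^2+\frac{\alpha(1+\alpha)G^2(9+12\tau_\alpha)}{2(1-\gamma)\lambda_{\min}}.$$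 Moreover, if $\gamma\ge 1/2$, the condition $2\alpha(1-\gamma)\lambda_{\min}<1+\alpha$ holds for every $\alpha>0$. -/

import Mathlib

open MeasureTheory

namespace ImplicitTD

/-- A discounted Markov decision process with finite state space `X` and finite action space `A`:
`P x a x'` is the probability of moving from `x` to `x'` under action `a`, `r x a` is the reward,
and `γ ∈ (0, 1)` is the discount factor. -/
structure FiniteMDP (X A : Type*) [Fintype X] where
  P : X → A → X → ℝ
  P_nonneg : ∀ x a x', 0 ≤ P x a x'
  P_sum : ∀ x a, ∑ x', P x a x' = 1
  r : X → A → ℝ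
  γ : ℝ
  γ_pos : 0 < γ
  γ_lt_one : γ < 1

/-- A (stationary, possibly randomized) policy: `prob x a` is the probability of choosing action
`a` in state `x`. -/
structure Policy (X A : Type*) [Fintype A] where
  prob : X → A → ℝ
  prob_nonneg : ∀ x a, 0 ≤ prob x a
  prob_sum : ∀ x, ∑ a, prob x a = 1

section Chain

variable {X A : Type*} [Fintype X] [Fintype A]

/-- The state transition matrix induced by the policy. -/
def transitionMatrix (M : FiniteMDP X A) (π : Policy X A) : Matrix X X ℝ :=
  Matrix.of fun x x' => ∑ a, M.P x a x' * π.prob x a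

/-- `μ` is a steady-state (stationary) probability distribution of the transition matrix `T`. -/
structure IsStationaryDist (T : Matrix X X ℝ) (μ : X → ℝ) : Prop where
  nonneg : ∀ x, 0 ≤ μ x
  sum_eq_one : ∑ x, μ x = 1
  invariant : Matrix.vecMul μ T = μ

/-- Aperiodicity: every state `x` has period one, the period being the greatest common divisor of
the possible return times to `x`. -/
def IsAperiodic [DecidableEq X] (T : Matrix X X ℝ) : Prop :=
  ∀ x, Nat.setGcd {n : ℕ | 0 < n ∧ 0 < (T ^ n) x x} = 1

/-- The chain is irreducible and aperiodic, and `μ` is its unique steady-state distribution, which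
charges every state. -/
structure IsErgodicChain [DecidableEq X] (T : Matrix X X ℝ) (μ : X → ℝ) : Prop where
  irreducible : T.IsIrreducible
  aperiodic : IsAperiodic T
  stationary : IsStationaryDist T μ
  unique : ∀ ν, IsStationaryDist T ν → ν = μ
  pos : ∀ x, 0 < μ x

/-- Total variation distance between two distributions on a finite set. -/
noncomputable def tvDist (p q : X → ℝ) : ℝ := (1 / 2) * ∑ x, |p x - q x|

/-- The chain mixes at the uniform geometric rate with constants `m > 0` and `ρ ∈ (0, 1)`:
`n` steps after any state, the law is within `m ρ ^ n` of `μ` in total variation. -/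
structure MixesGeometrically [DecidableEq X] (T : Matrix X X ℝ) (μ : X → ℝ) (m ρ : ℝ) :
    Prop where
  m_pos : 0 < m
  ρ_pos : 0 < ρ
  ρ_lt_one : ρ < 1
  bound : ∀ (n : ℕ) (x : X), tvDist (fun y => (T ^ n) x y) μ ≤ m * ρ ^ n

/-- The mixing time `τ_ε = min {n | m ρ ^ n ≤ ε}`. -/
noncomputable def mixingTime (m ρ ε : ℝ) : ℕ := sInf {n : ℕ | m * ρ ^ n ≤ ε}

/-- The random sequences of states `x` and actions `a` form a trajectory of the process under the
policy `π`, with initial state distribution `μ` (time starts at `0`): the joint law of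
`(x 0, a 0, x 1, …, a (n-1), x n)` is the product of the initial, action and transition
probabilities. -/
structure IsTrajectory (M : FiniteMDP X A) (π : Policy X A) (μ : X → ℝ)
    [MeasurableSpace X] [MeasurableSpace A] {Ω : Type*} [MeasurableSpace Ω] (ℙ : Measure Ω)
    (x : ℕ → Ω → X) (a : ℕ → Ω → A) : Prop where
  measurable_state : ∀ n, Measurable (x n)
  measurable_action : ∀ n, Measurable (a n)
  law : ∀ (n : ℕ) (s : ℕ → X) (b : ℕ → A),
    ℙ.real {ω | (∀ i ≤ n, x i ω = s i) ∧ ∀ i < n, a i ω = b i} =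
      μ (s 0) * ∏ i ∈ Finset.range n, π.prob (s i) (b i) * M.P (s i) (b i) (s (i + 1))

/-- Steady-state expectation of a function of one transition `(x_n, a_n, x_{n+1})`. -/
noncomputable def steadyMean (M : FiniteMDP X A) (π : Policy X A) (μ : X → ℝ)
    {V : Type*} [AddCommGroup V] [Module ℝ V] (f : X → A → X → V) : V :=
  ∑ x, ∑ a, ∑ x', (μ x * π.prob x a * M.P x a x') • f x a x'

end Chain

section Features

variable {X A : Type*} [Fintype X] {d : ℕ}

/-- The feature matrix `Φ`, whose row at the state `x` is `φ(x)ᵀ`. -/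
def featureMatrix (φ : X → EuclideanSpace ℝ (Fin d)) : Matrix X (Fin d) ℝ :=
  Matrix.of fun x i => φ x i

/-- The steady-state feature covariance matrix `Σ = Φᵀ D Φ`, where `D = diag(μ)`. -/
def featureCov [DecidableEq X] (μ : X → ℝ) (φ : X → EuclideanSpace ℝ (Fin d)) :
    Matrix (Fin d) (Fin d) ℝ :=
  (featureMatrix φ).transpose * Matrix.diagonal μ * featureMatrix φ

/-- The minimum eigenvalue `λ_min` of the feature covariance matrix. -/
noncomputable def lambdaMin [DecidableEq X] (μ : X → ℝ) (φ : X → EuclideanSpace ℝ (Fin d)) : ℝ :=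
  sInf {l : ℝ | Module.End.HasEigenvalue (Matrix.toLin' (featureCov μ φ)) l}

/-- `w` solves the TD(0) equation `E_∞(φ_n φ_nᵀ - γ φ_n φ_{n+1}ᵀ) w = E_∞(r_n φ_n)`. -/
def IsTDSolution [Fintype A] (M : FiniteMDP X A) (π : Policy X A) (μ : X → ℝ)
    (φ : X → EuclideanSpace ℝ (Fin d)) (w : EuclideanSpace ℝ (Fin d)) : Prop :=
  steadyMean M π μ (fun x _ x' => (inner ℝ (φ x) w - M.γ * inner ℝ (φ x') w) • φ x) =
    steadyMean M π μ (fun x a _ => M.r x a • φ x)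

/-- Projection onto the closed Euclidean ball of radius `R`. -/
noncomputable def projBall (R : ℝ) (w : EuclideanSpace ℝ (Fin d)) : EuclideanSpace ℝ (Fin d) :=
  if R < ‖w‖ then (R / ‖w‖) • w else w

/-- One implicit TD(0) update (before projection) with step size `α` along the transition
`(x, a, x')`. -/
noncomputable def implicitStep (M : FiniteMDP X A) (φ : X → EuclideanSpace ℝ (Fin d)) (α : ℝ)
    (x : X) (a : A) (x' : X) (w : EuclideanSpace ℝ (Fin d)) : EuclideanSpace ℝ (Fin d) :=
  w + (α / (1 + α * ‖φ x‖ ^ 2)) •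
    ((M.r x a + M.γ * inner ℝ (φ x') w - inner ℝ (φ x) w) • φ x)

/-- The explicit update solves the implicit fixed-point equation that defines it, in which the
new iterate also appears on the right-hand side. -/
theorem implicitStep_fixedPoint (M : FiniteMDP X A) (φ : X → EuclideanSpace ℝ (Fin d)) {α : ℝ}
    (hα : 0 ≤ α) (x : X) (a : A) (x' : X) (w : EuclideanSpace ℝ (Fin d)) :
    implicitStep M φ α x a x' w =
      w + α • ((M.r x a + M.γ * inner ℝ (φ x') w
        - inner ℝ (φ x) (implicitStep M φ α x a x' w)) • φ x) := by
  have h : 1 + α * ‖φ x‖ ^ 2 ≠ 0 := by positivity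
  unfold implicitStep
  rw [inner_add_right, inner_smul_right, inner_smul_right, real_inner_self_eq_norm_sq,
    smul_smul, smul_smul]
  congr 2
  field_simp
  ring

/-- The projected implicit TD(0) iterates with constant step size `α`, projection radius `R` and
initial guess `w₁`, run along the path of states `x` and actions `a`. Time starts at `0`, so
`projImplicitTD0 … n` is the iterate obtained after `n` updates, usually written `w_{n+1}`. -/
noncomputable def projImplicitTD0 (M : FiniteMDP X A) (φ : X → EuclideanSpace ℝ (Fin d))
    (α R : ℝ) (w₁ : EuclideanSpace ℝ (Fin d)) (x : ℕ → X) (a : ℕ → A) :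
    ℕ → EuclideanSpace ℝ (Fin d)
  | 0 => w₁
  | n + 1 => projBall R
      (implicitStep M φ α (x n) (a n) (x (n + 1)) (projImplicitTD0 M φ α R w₁ x a n))

end Features

end ImplicitTD

open ImplicitTD

/-!
The mean squared error `V n` of the iterates obeys, up to errors of order `α ^ 2`, the recursion of
the averaged dynamics. Write `c = (1 - γ) λ_min` and `G = r_max + 2 R`.

* In the steady state the drift `⟪w - w⋆, g(w)⟫` of the semi-gradient `g` is at most
  `-c ‖w - w⋆‖ ^ 2` (`steadyMean_tdDrift_le`): the cross term of `φ_n` and `φ_{n+1}` is absorbed by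
  stationarity, and `λ_min` is the minimum of the Rayleigh quotient of the covariance. The same
  coercivity makes the temporal-difference equation uniquely solvable.
* Pathwise, one projected implicit step adds `2 α` times the drift and errors of order `α ^ 2`,
  including the error of replacing the effective step size `α / (1 + α ‖φ‖ ^ 2)` by `α`
  (`norm_projBall_implicitStep_sub_sq_le`).
* The drift at time `n` is evaluated at an iterate that is correlated with the transition. It is
  compared with the drift at the iterate from `τ_α` steps earlier, which is at distance at most
  `α τ_α G` (`integral_tdDrift_le_of_norm_sub_le`), and of which the transition is nearly
  independent by the Markov property and the mixing bound (`integral_tdDrift_le_of_tvDist_le`).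

Altogether `V (n + 1) ≤ (1 - 2 α c / (1 + α)) V n + α ^ 2 G ^ 2 (7 + 12 τ_α)` for `n > τ_α`. The
initial guess may lie outside the ball of radius `R`, so that the first `τ_α + 1` steps need a
separate argument: there the iterate is compared with the deterministic vector `Π_R w₁`, at which
stationarity gives the exact steady-state drift, and the resulting larger errors are summed
(`le_of_recursion`).

The mixing constants exist because an irreducible aperiodic matrix has a positive power
(`isPrimitive_of_irreducible_aperiodic`), which contracts the `ℓ¹` norm on vectors of total mass
zero (`sum_abs_vecMul_le`).
-/

namespace ImplicitTD

/-! ### Geometric ergodicity of irreducible aperiodic chains -/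

theorem transitionMatrix_mem_rowStochastic {X A : Type*} [Fintype X] [DecidableEq X] [Fintype A]
    (M : FiniteMDP X A) (π : Policy X A) :
    transitionMatrix M π ∈ Matrix.rowStochastic ℝ X := by
  rw [Matrix.mem_rowStochastic_iff_sum]
  refine ⟨fun i j => Finset.sum_nonneg fun a _ =>
    mul_nonneg (M.P_nonneg _ _ _) (π.prob_nonneg _ _), fun i => ?_⟩
  simp only [transitionMatrix, Matrix.of_apply]
  rw [Finset.sum_comm]
  simp_rw [← Finset.sum_mul, M.P_sum, one_mul, π.prob_sum]

theorem mul_le_pow_add_apply {X : Type*} [Fintype X] [DecidableEq X] {T : Matrix X X ℝ}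
    (hT : ∀ i j, 0 ≤ T i j) (m n : ℕ) (i j k : X) :
    (T ^ m) i j * (T ^ n) j k ≤ (T ^ (m + n)) i k := by
  rw [pow_add, Matrix.mul_apply]
  exact Finset.single_le_sum (f := fun l => (T ^ m) i l * (T ^ n) l k)
    (fun l _ => mul_nonneg (Matrix.pow_apply_nonneg hT _ _ _) (Matrix.pow_apply_nonneg hT _ _ _))
    (Finset.mem_univ j)

/-- An irreducible aperiodic matrix is primitive: the return times to a state are closed under
addition and have greatest common divisor one, hence contain all large integers. -/
theorem isPrimitive_of_irreducible_aperiodic {X : Type*} [Fintype X] [DecidableEq X]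
    {T : Matrix X X ℝ} (hirr : T.IsIrreducible) (hap : IsAperiodic T) : T.IsPrimitive := by
  have hT := hirr.nonneg
  have hret : ∀ x, ∃ n, ∀ m ≥ n, 0 < (T ^ m) x x := by
    intro x
    obtain ⟨n, hn⟩ := Nat.exists_mem_closure_of_ge {n : ℕ | 0 < n ∧ 0 < (T ^ n) x x}
    refine ⟨n, fun m hm => ?_⟩
    have hmem := hn m hm (by rw [hap x]; exact one_dvd m)
    clear hm
    induction hmem using AddSubmonoid.closure_induction with
    | mem y hy => exact hy.2
    | zero => simp
    | add y z _ _ hy hz => exact (mul_pos hy hz).trans_le (mul_le_pow_add_apply hT y z x x x)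
  choose n hn using hret
  have hconn := (Matrix.isIrreducible_iff_exists_pow_pos hT).1 hirr
  choose k hk hkpos using hconn
  refine ⟨hT, ∑ x, n x + ∑ x, ∑ y, k x y + 1, by omega, fun i j => ?_⟩
  have h1 : n i ≤ ∑ x, n x := Finset.single_le_sum (fun _ _ => Nat.zero_le _) (Finset.mem_univ i)
  have h2 : k i j ≤ ∑ x, ∑ y, k x y :=
    (Finset.single_le_sum (f := fun y => k i y) (fun _ _ => Nat.zero_le _)
      (Finset.mem_univ j)).trans
    (Finset.single_le_sum (f := fun x => ∑ y, k x y) (fun _ _ => Nat.zero_le _)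
      (Finset.mem_univ i))
  obtain ⟨l, hl⟩ := Nat.exists_eq_add_of_le h2
  have h3 : ∑ x, n x + ∑ x, ∑ y, k x y + 1 = (∑ x, n x + l + 1) + k i j := by omega
  rw [h3]
  exact (mul_pos (hn i _ (by omega)) (hkpos i j)).trans_le (mul_le_pow_add_apply hT _ _ i i j)

/-- Doeblin's contraction: a stochastic matrix whose rows all dominate `δ ν` contracts the `ℓ¹`
norm of vectors of total mass zero by the factor `1 - δ`. -/
theorem sum_abs_vecMul_le {X : Type*} [Fintype X] {S : Matrix X X ℝ} {ν v : X → ℝ} {δ : ℝ}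
    (hS : ∀ i, ∑ j, S i j = 1) (hν : ∑ j, ν j = 1) (hδ : ∀ i j, δ * ν j ≤ S i j)
    (hv : ∑ i, v i = 0) :
    ∑ j, |Matrix.vecMul v S j| ≤ (1 - δ) * ∑ i, |v i| := by
  have h1 : ∀ j, Matrix.vecMul v S j = ∑ i, v i * (S i j - δ * ν j) := by
    intro j
    simp only [Matrix.vecMul, dotProduct, mul_sub, Finset.sum_sub_distrib]
    rw [← Finset.sum_mul, hv]; ring
  calc ∑ j, |Matrix.vecMul v S j| ≤ ∑ j, ∑ i, |v i| * (S i j - δ * ν j) := by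
        refine Finset.sum_le_sum fun j _ => ?_
        rw [h1]
        refine (Finset.abs_sum_le_sum_abs _ _).trans (Finset.sum_le_sum fun i _ => ?_)
        rw [abs_mul, abs_of_nonneg (sub_nonneg.2 (hδ i j))]
    _ = (1 - δ) * ∑ i, |v i| := by
        rw [Finset.sum_comm]
        simp_rw [← Finset.mul_sum, Finset.sum_sub_distrib, hS, ← Finset.mul_sum, hν]
        rw [← Finset.sum_mul]; ring

/-- A nonincreasing sequence that shrinks by a fixed factor every `k` steps decays
geometrically, uniformly over any family of such sequences. -/
theorem exists_geometric_bound {ι : Type*} {u : ι → ℕ → ℝ} {k : ℕ} {q : ℝ} (hk : 0 < k)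
    (hq0 : 0 < q) (hq1 : q < 1) (hu : ∀ i, Antitone (u i)) (hu0 : ∀ i, u i 0 ≤ 1)
    (huk : ∀ i n, u i (n + k) ≤ q * u i n) :
    ∃ m ρ : ℝ, 0 < m ∧ 0 < ρ ∧ ρ < 1 ∧ ∀ i n, u i n ≤ m * ρ ^ n := by
  have hk0 : k ≠ 0 := hk.ne'
  have hρk : (q ^ (1 / (k : ℝ))) ^ k = q := by
    rw [one_div]; exact Real.rpow_inv_natCast_pow hq0.le hk0
  have hρ0 : 0 < q ^ (1 / (k : ℝ)) := Real.rpow_pos_of_pos hq0 _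
  have hρ1 : q ^ (1 / (k : ℝ)) < 1 := Real.rpow_lt_one hq0.le hq1 (by positivity)
  generalize q ^ (1 / (k : ℝ)) = ρ at *
  refine ⟨q⁻¹, ρ, by positivity, hρ0, hρ1, fun i n => ?_⟩
  induction n using Nat.strong_induction_on with
  | _ n ih =>
    rcases lt_or_ge n k with h | h
    · have h1 : ρ ^ k ≤ ρ ^ n := pow_le_pow_of_le_one hρ0.le hρ1.le h.le
      calc u i n ≤ u i 0 := hu i (Nat.zero_le _)
        _ ≤ q⁻¹ * q := by rw [inv_mul_cancel₀ hq0.ne']; exact hu0 i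
        _ ≤ q⁻¹ * ρ ^ n := by rw [hρk] at h1; gcongr
    · obtain ⟨l, rfl⟩ := Nat.exists_eq_add_of_le' h
      calc u i (l + k) ≤ q * u i l := huk i l
        _ ≤ q * (q⁻¹ * ρ ^ l) := by gcongr; exact ih l (by omega)
        _ = q⁻¹ * ρ ^ (l + k) := by rw [pow_add, hρk]; ring

theorem vecMul_pow_eq {X : Type*} [Fintype X] [DecidableEq X] {T : Matrix X X ℝ} {μ : X → ℝ}
    (hμ : Matrix.vecMul μ T = μ) (n : ℕ) : Matrix.vecMul μ (T ^ n) = μ := by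
  induction n with
  | zero => simp
  | succ n ih => rw [pow_succ, ← Matrix.vecMul_vecMul, ih, hμ]

theorem tvDist_pow_eq {X : Type*} [Fintype X] [DecidableEq X] {T : Matrix X X ℝ} {μ : X → ℝ}
    (hμ : Matrix.vecMul μ T = μ) (n : ℕ) (x : X) :
    tvDist (fun y => (T ^ n) x y) μ =
      (1 / 2) * ∑ y, |Matrix.vecMul (Pi.single x 1 - μ) (T ^ n) y| := by
  simp only [tvDist, Matrix.sub_vecMul, vecMul_pow_eq hμ, Matrix.single_one_vecMul, Pi.sub_apply]
  rfl

theorem exists_mixesGeometrically {X : Type*} [Fintype X] [DecidableEq X] {T : Matrix X X ℝ}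
    {μ : X → ℝ} (hT : T ∈ Matrix.rowStochastic ℝ X) (h : IsErgodicChain T μ) :
    ∃ m ρ : ℝ, MixesGeometrically T μ m ρ := by
  obtain ⟨-, k, hk, hpos⟩ := isPrimitive_of_irreducible_aperiodic h.irreducible h.aperiodic
  have hμ := h.stationary
  have hrow : ∀ n i, ∑ j, (T ^ n) i j = 1 := fun n =>
    ((Matrix.mem_rowStochastic_iff_sum).1 (pow_mem hT n)).2
  have hne : Nonempty X := by
    by_contra hc
    rw [not_nonempty_iff] at hc
    simpa using hμ.sum_eq_one
  have hle1 : ∀ y, μ y ≤ 1 := fun y => by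
    rw [← hμ.sum_eq_one]
    exact Finset.single_le_sum (fun i _ => hμ.nonneg i) (Finset.mem_univ y)
  obtain ⟨⟨i₀, j₀⟩, hmin⟩ := Finite.exists_min fun p : X × X => (T ^ k) p.1 p.2
  set δ := (T ^ k) i₀ j₀ / 2 with hδ
  have hδ0 : 0 < δ := half_pos (hpos _ _)
  have hδ1 : δ < 1 := by
    have : (T ^ k) i₀ j₀ ≤ 1 := by
      rw [← hrow k i₀]
      exact Finset.single_le_sum (f := fun j => (T ^ k) i₀ j) (fun j _ => (hpos _ _).le)
        (Finset.mem_univ j₀)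
    linarith
  have hdom : ∀ i j, δ * μ j ≤ (T ^ k) i j := fun i j => by
    have h1 : (T ^ k) i₀ j₀ ≤ (T ^ k) i j := hmin (i, j)
    nlinarith [hle1 j, hμ.nonneg j]
  set v : X → ℕ → X → ℝ := fun x n => Matrix.vecMul (Pi.single x 1 - μ) (T ^ n) with hv
  have hv0 : ∀ x n, ∑ y, v x n y = 0 := by
    intro x n
    simp only [hv, Matrix.vecMul, dotProduct]
    rw [Finset.sum_comm]
    simp_rw [← Finset.mul_sum, hrow, mul_one, Pi.sub_apply, Finset.sum_sub_distrib, hμ.sum_eq_one]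
    simp
  have hstep : ∀ x n l, v x (n + l) = Matrix.vecMul (v x n) (T ^ l) := fun x n l => by
    simp only [hv, Matrix.vecMul_vecMul, pow_add]
  obtain ⟨m, ρ, hm, hρ0, hρ1, hb⟩ := exists_geometric_bound
    (u := fun x n => (1 / 2) * ∑ y, |v x n y|) hk (sub_pos.2 hδ1) (by linarith : 1 - δ < 1)
    (fun x => antitone_nat_of_succ_le fun n => by
      have := sum_abs_vecMul_le (δ := 0) (hrow 1) hμ.sum_eq_one (fun i j => by
        rw [zero_mul, pow_one]; exact h.irreducible.nonneg i j) (hv0 x n)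
      rw [← hstep] at this
      linarith)
    (fun x => by
      have h1 : ∑ y, |v x 0 y| ≤ ∑ y, (|(Pi.single x 1 : X → ℝ) y| + |μ y|) := by
        refine Finset.sum_le_sum fun y _ => ?_
        simp only [hv, pow_zero, Matrix.vecMul_one, Pi.sub_apply]
        exact abs_sub _ _
      have h2 : ∑ y, (|(Pi.single x 1 : X → ℝ) y| + |μ y|) = 2 := by
        rw [Finset.sum_add_distrib]
        simp_rw [fun y => abs_of_nonneg (hμ.nonneg y), hμ.sum_eq_one]
        have : ∀ y, |(Pi.single x 1 : X → ℝ) y| = (Pi.single x 1 : X → ℝ) y := fun y => by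
          apply abs_of_nonneg
          by_cases hy : y = x
          · subst hy; simp
          · simp [hy]
        simp_rw [this]
        simp; norm_num
      linarith)
    (fun x n => by
      have := sum_abs_vecMul_le (hrow k) hμ.sum_eq_one hdom (hv0 x n)
      rw [← hstep] at this
      linarith)
  exact ⟨m, ρ, hm, hρ0, hρ1, fun n x => by rw [tvDist_pow_eq hμ.invariant]; exact hb x n⟩

/-! ### Steady-state means and the feature covariance -/

section SteadyMean

variable {X A : Type*} [Fintype X] [Fintype A] {M : FiniteMDP X A} {π : Policy X A} {μ : X → ℝ}

theorem steadyMean_add {V : Type*} [AddCommGroup V] [Module ℝ V] (f g : X → A → X → V) :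
    steadyMean M π μ (fun x a x' => f x a x' + g x a x') =
      steadyMean M π μ f + steadyMean M π μ g := by
  simp only [steadyMean, smul_add, Finset.sum_add_distrib]

theorem steadyMean_sub {V : Type*} [AddCommGroup V] [Module ℝ V] (f g : X → A → X → V) :
    steadyMean M π μ (fun x a x' => f x a x' - g x a x') =
      steadyMean M π μ f - steadyMean M π μ g := by
  simp only [steadyMean, smul_sub, Finset.sum_sub_distrib]

theorem steadyMean_smul {V : Type*} [AddCommGroup V] [Module ℝ V] (c : ℝ) (f : X → A → X → V) :
    steadyMean M π μ (fun x a x' => c • f x a x') = c • steadyMean M π μ f := by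
  simp only [steadyMean, Finset.smul_sum, smul_comm c]

theorem inner_steadyMean {V : Type*} [NormedAddCommGroup V] [InnerProductSpace ℝ V] (v : V)
    (f : X → A → X → V) :
    inner ℝ v (steadyMean M π μ f) = steadyMean M π μ (fun x a x' => inner ℝ v (f x a x')) := by
  simp only [steadyMean, inner_sum, inner_smul_right, smul_eq_mul]

theorem steadyMean_mono (hμ : ∀ x, 0 ≤ μ x) {f g : X → A → X → ℝ}
    (h : ∀ x a x', π.prob x a ≠ 0 → f x a x' ≤ g x a x') :
    steadyMean M π μ f ≤ steadyMean M π μ g := by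
  refine Finset.sum_le_sum fun x _ => Finset.sum_le_sum fun a _ => Finset.sum_le_sum fun x' _ => ?_
  by_cases h0 : π.prob x a = 0
  · simp [h0]
  · exact mul_le_mul_of_nonneg_left (h x a x' h0)
      (mul_nonneg (mul_nonneg (hμ x) (π.prob_nonneg x a)) (M.P_nonneg x a x'))

theorem steadyMean_state (f : X → ℝ) :
    steadyMean M π μ (fun x _ _ => f x) = ∑ x, μ x * f x := by
  simp only [steadyMean, smul_eq_mul, ← Finset.sum_mul, ← Finset.mul_sum, M.P_sum, mul_one,
    π.prob_sum]

theorem steadyMean_next (hμ : Matrix.vecMul μ (transitionMatrix M π) = μ) (f : X → ℝ) :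
    steadyMean M π μ (fun _ _ x' => f x') = ∑ x, μ x * f x := by
  have h : ∀ y, ∑ x, μ x * ∑ a, M.P x a y * π.prob x a = μ y := fun y => congrFun hμ y
  simp only [steadyMean, smul_eq_mul]
  simp_rw [Finset.sum_comm (s := (Finset.univ : Finset A))]
  rw [Finset.sum_comm]
  refine Finset.sum_congr rfl fun y _ => ?_
  rw [← h y, Finset.sum_mul]
  refine Finset.sum_congr rfl fun x _ => ?_
  rw [Finset.mul_sum, Finset.sum_mul]
  exact Finset.sum_congr rfl fun a _ => by ring

end SteadyMean

section Covariance

theorem featureMatrix_mulVec {X : Type*} {d : ℕ} {φ : X → EuclideanSpace ℝ (Fin d)}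
    (w : EuclideanSpace ℝ (Fin d)) (x : X) :
    Matrix.mulVec (featureMatrix φ) w x = inner ℝ (φ x) w := by
  simp [featureMatrix, Matrix.mulVec, dotProduct, PiLp.inner_apply, mul_comm]

/-- Full column rank means that only the zero parameter has identically vanishing values. -/
theorem eq_zero_of_forall_inner_eq_zero {X : Type*} {d : ℕ}
    {φ : X → EuclideanSpace ℝ (Fin d)} (hrank : (featureMatrix φ).rank = d)
    {w : EuclideanSpace ℝ (Fin d)} (hw : ∀ x, inner ℝ (φ x) w = 0) : w = 0 := by
  have h := LinearMap.finrank_range_add_finrank_ker (featureMatrix φ).mulVecLin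
  rw [Module.finrank_fin_fun] at h
  have h2 : Module.finrank ℝ (LinearMap.ker (featureMatrix φ).mulVecLin) = 0 := by
    unfold Matrix.rank at hrank
    omega
  rw [Submodule.finrank_eq_zero] at h2
  have h3 : w.ofLp ∈ LinearMap.ker (featureMatrix φ).mulVecLin := by
    rw [LinearMap.mem_ker, Matrix.mulVecLin_apply]
    funext x
    rw [featureMatrix_mulVec, hw]; rfl
  rw [h2, Submodule.mem_bot] at h3
  exact (WithLp.ofLp_eq_zero 2).1 h3

variable {X : Type*} [Fintype X] {d : ℕ} {μ : X → ℝ}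
  {φ : X → EuclideanSpace ℝ (Fin d)}

theorem inner_toEuclideanLin_featureCov [DecidableEq X] (w : EuclideanSpace ℝ (Fin d)) :
    inner ℝ (Matrix.toEuclideanLin (featureCov μ φ) w) w =
      ∑ x, μ x * (inner ℝ (φ x) w) ^ 2 := by
  rw [EuclideanSpace.inner_eq_star_dotProduct, Matrix.ofLp_toLpLin, Matrix.toLin'_apply,
    star_trivial,
    featureCov, ← Matrix.mulVec_mulVec, ← Matrix.mulVec_mulVec, Matrix.dotProduct_mulVec,
    Matrix.vecMul_transpose]
  simp only [dotProduct, Matrix.mulVec_diagonal, featureMatrix_mulVec]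
  exact Finset.sum_congr rfl fun x _ => by ring

theorem isSymmetric_toEuclideanLin_featureCov [DecidableEq X] :
    (Matrix.toEuclideanLin (featureCov μ φ)).IsSymmetric := by
  rw [Matrix.isSymmetric_toEuclideanLin_iff]
  simp [Matrix.IsHermitian, featureCov, Matrix.conjTranspose_eq_transpose_of_trivial,
    Matrix.mul_assoc]

theorem hasEigenvalue_toEuclideanLin_iff {ι : Type*} [Fintype ι] [DecidableEq ι]
    (B : Matrix ι ι ℝ) (l : ℝ) :
    Module.End.HasEigenvalue (Matrix.toEuclideanLin B) l ↔
      Module.End.HasEigenvalue (Matrix.toLin' B) l := by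
  constructor
  · intro h
    obtain ⟨v, hv⟩ := h.exists_hasEigenvector
    refine Module.End.hasEigenvalue_of_hasEigenvector (x := v.ofLp)
      ⟨Module.End.mem_eigenspace_iff.2 ?_, fun h0 => hv.2 ((WithLp.ofLp_eq_zero 2).1 h0)⟩
    have := congrArg WithLp.ofLp hv.apply_eq_smul
    simpa using this
  · intro h
    obtain ⟨v, hv⟩ := h.exists_hasEigenvector
    refine Module.End.hasEigenvalue_of_hasEigenvector (x := WithLp.toLp 2 v)
      ⟨Module.End.mem_eigenspace_iff.2 ?_, fun h0 => hv.2 ((WithLp.toLp_eq_zero 2).1 h0)⟩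
    have := congrArg (WithLp.toLp 2) hv.apply_eq_smul
    simpa using this

theorem sum_mul_inner_sq_pos (hμ : ∀ x, 0 < μ x) (hrank : (featureMatrix φ).rank = d)
    {w : EuclideanSpace ℝ (Fin d)} (hw : w ≠ 0) : 0 < ∑ x, μ x * (inner ℝ (φ x) w) ^ 2 := by
  have h0 : ∀ x ∈ Finset.univ, 0 ≤ μ x * (inner ℝ (φ x) w : ℝ) ^ 2 := fun x _ =>
    mul_nonneg (hμ x).le (sq_nonneg _)
  refine lt_of_le_of_ne (Finset.sum_nonneg h0) fun h => hw ?_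
  refine eq_zero_of_forall_inner_eq_zero hrank fun x => ?_
  have := (Finset.sum_eq_zero_iff_of_nonneg h0).1 h.symm x (Finset.mem_univ x)
  simpa [(hμ x).ne'] using this

theorem exists_eigenvector_featureCov [DecidableEq X] {l : ℝ}
    (h : Module.End.HasEigenvalue (Matrix.toLin' (featureCov μ φ)) l) :
    ∃ v : EuclideanSpace ℝ (Fin d), v ≠ 0 ∧
      l * ‖v‖ ^ 2 = ∑ x, μ x * (inner ℝ (φ x) v) ^ 2 := by
  obtain ⟨v, hv⟩ := ((hasEigenvalue_toEuclideanLin_iff _ _).2 h).exists_hasEigenvector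
  refine ⟨v, hv.2, ?_⟩
  rw [← inner_toEuclideanLin_featureCov, hv.apply_eq_smul, inner_smul_left,
    real_inner_self_eq_norm_sq]
  rfl

theorem pos_of_hasEigenvalue_featureCov [DecidableEq X] (hμ : ∀ x, 0 < μ x)
    (hrank : (featureMatrix φ).rank = d) {l : ℝ}
    (h : Module.End.HasEigenvalue (Matrix.toLin' (featureCov μ φ)) l) : 0 < l := by
  obtain ⟨v, hv, hl⟩ := exists_eigenvector_featureCov h
  have h1 := sum_mul_inner_sq_pos hμ hrank hv
  rw [← hl] at h1
  exact pos_of_mul_pos_left h1 (by positivity)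

/-- The infimum defining `λ_min` is attained, by the minimum of the Rayleigh quotient. -/
theorem lambdaMin_pos_and_mul_norm_sq_le [DecidableEq X] (hd : 0 < d) (hμ : ∀ x, 0 < μ x)
    (hrank : (featureMatrix φ).rank = d) :
    0 < lambdaMin μ φ ∧ ∀ w, lambdaMin μ φ * ‖w‖ ^ 2 ≤ ∑ x, μ x * (inner ℝ (φ x) w) ^ 2 := by
  have : Nonempty (Fin d) := ⟨⟨0, hd⟩⟩
  have : Nontrivial (EuclideanSpace ℝ (Fin d)) :=
    inferInstance
  have hray := (isSymmetric_toEuclideanLin_featureCov (μ := μ)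
    (φ := φ)).hasEigenvalue_iInf_of_finiteDimensional
  rw [hasEigenvalue_toEuclideanLin_iff] at hray
  set S := {l : ℝ | Module.End.HasEigenvalue (Matrix.toLin' (featureCov μ φ)) l} with hS
  have hbdd : BddBelow S := ⟨0, fun l hl => (pos_of_hasEigenvalue_featureCov hμ hrank hl).le⟩
  have hfin : S.Finite := by
    refine (Module.End.finite_spectrum (Matrix.toLin' (featureCov μ φ))).subset fun l hl => ?_
    exact Module.End.hasEigenvalue_iff_mem_spectrum.1 hl
  have hne : S.Nonempty := ⟨_, hray⟩
  refine ⟨pos_of_hasEigenvalue_featureCov hμ hrank (hne.csInf_mem hfin), fun w => ?_⟩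
  by_cases hw : w = 0
  · simp [hw]
  have h1 : lambdaMin μ φ ≤ (∑ x, μ x * (inner ℝ (φ x) w) ^ 2) / ‖w‖ ^ 2 := by
    refine (csInf_le hbdd hray).trans ?_
    refine (ciInf_le ⟨0, ?_⟩ (⟨w, hw⟩ : {x : EuclideanSpace ℝ (Fin d) // x ≠ 0})).trans ?_
    · rintro _ ⟨y, rfl⟩
      simp only [RCLike.re_to_real]
      rw [inner_toEuclideanLin_featureCov]
      exact div_nonneg (Finset.sum_nonneg fun x _ => mul_nonneg (hμ x).le (sq_nonneg _))
        (sq_nonneg _)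
    · simp only [RCLike.re_to_real]
      rw [inner_toEuclideanLin_featureCov]
  have hpos : 0 < ‖w‖ ^ 2 := by positivity
  exact (le_div_iff₀ hpos).1 h1

theorem lambdaMin_eq_zero_of_dim_zero [DecidableEq X] (hd : d = 0) : lambdaMin μ φ = 0 := by
  have : {l : ℝ | Module.End.HasEigenvalue (Matrix.toLin' (featureCov μ φ)) l} = ∅ := by
    ext l
    simp only [Set.mem_ofPred_eq, Set.mem_empty_iff_false, iff_false]
    intro h
    obtain ⟨v, hv, -⟩ := exists_eigenvector_featureCov h
    subst hd
    exact hv (Subsingleton.elim _ _)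
  rw [lambdaMin, this, Real.sInf_empty]

theorem lambdaMin_le_one [DecidableEq X] (hμ : ∀ x, 0 < μ x) (hsum : ∑ x, μ x = 1)
    (hrank : (featureMatrix φ).rank = d) (hφ : ∀ x, ‖φ x‖ ≤ 1) : lambdaMin μ φ ≤ 1 := by
  rcases Nat.eq_zero_or_pos d with hd | hd
  · rw [lambdaMin_eq_zero_of_dim_zero hd]; exact zero_le_one
  have : Nonempty (Fin d) := ⟨⟨0, hd⟩⟩
  obtain ⟨w, hw⟩ := exists_ne (0 : EuclideanSpace ℝ (Fin d))
  have h1 := (lambdaMin_pos_and_mul_norm_sq_le hd hμ hrank).2 w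
  have h2 : ∑ x, μ x * (inner ℝ (φ x) w : ℝ) ^ 2 ≤ ∑ x, μ x * ‖w‖ ^ 2 := by
    refine Finset.sum_le_sum fun x _ => mul_le_mul_of_nonneg_left ?_ (hμ x).le
    rw [← sq_abs]
    have := (abs_real_inner_le_norm (φ x) w).trans
      (mul_le_of_le_one_left (norm_nonneg w) (hφ x))
    gcongr
  rw [← Finset.sum_mul, hsum] at h2
  have hpos : 0 < ‖w‖ ^ 2 := by positivity
  exact le_of_mul_le_mul_right (h1.trans h2) hpos

end Covariance

/-! ### The temporal-difference equation -/

section TD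

variable {X A : Type*} [Fintype X] {d : ℕ}

/-- The temporal-difference error `r + γ φ(x')ᵀ w - φ(x)ᵀ w` along the transition `(x, a, x')`. -/
noncomputable def tdError (M : FiniteMDP X A) (φ : X → EuclideanSpace ℝ (Fin d))
    (x : X) (a : A) (x' : X) (w : EuclideanSpace ℝ (Fin d)) : ℝ :=
  M.r x a + M.γ * inner ℝ (φ x') w - inner ℝ (φ x) w

/-- The drift of TD(0) along the transition `(x, a, x')`: the inner product of the semi-gradient
`tdError • φ(x)` at `w` with the displacement `w - v` from the target `v`. -/
noncomputable def tdDrift (M : FiniteMDP X A) (φ : X → EuclideanSpace ℝ (Fin d))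
    (v : EuclideanSpace ℝ (Fin d)) (w : EuclideanSpace ℝ (Fin d)) (x : X) (a : A) (x' : X) : ℝ :=
  tdError M φ x a x' w * inner ℝ (φ x) (w - v)

theorem tdError_eq_add (M : FiniteMDP X A) (φ : X → EuclideanSpace ℝ (Fin d))
    (x : X) (a : A) (x' : X) (w v : EuclideanSpace ℝ (Fin d)) :
    tdError M φ x a x' w =
      tdError M φ x a x' v + (M.γ * inner ℝ (φ x') (w - v) - inner ℝ (φ x) (w - v)) := by
  simp only [tdError, inner_sub_right]; ring

/-- The linear map `E_∞(φ_n φ_nᵀ - γ φ_n φ_{n+1}ᵀ)` of the temporal-difference equation. -/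
noncomputable def tdMap [Fintype A] (M : FiniteMDP X A) (π : Policy X A) (μ : X → ℝ)
    (φ : X → EuclideanSpace ℝ (Fin d)) :
    EuclideanSpace ℝ (Fin d) →ₗ[ℝ] EuclideanSpace ℝ (Fin d) where
  toFun w := steadyMean M π μ
    (fun x _ x' => (inner ℝ (φ x) w - M.γ * inner ℝ (φ x') w) • φ x)
  map_add' v w := by
    rw [← steadyMean_add]
    congr 1
    funext x a x'
    rw [← add_smul, inner_add_right, inner_add_right]
    congr 1; ring
  map_smul' c w := by
    rw [RingHom.id_apply, ← steadyMean_smul]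
    congr 1
    funext x a x'
    rw [smul_smul, inner_smul_right, inner_smul_right]
    congr 1; ring

variable [Fintype A] {M : FiniteMDP X A} {π : Policy X A} {μ : X → ℝ}
  {φ : X → EuclideanSpace ℝ (Fin d)}

/-- Coercivity of the temporal-difference map; the cross term is absorbed by stationarity, under
which `φ_n` and `φ_{n+1}` have the same covariance. -/
theorem le_inner_tdMap (hμ0 : ∀ x, 0 ≤ μ x)
    (hμ : Matrix.vecMul μ (transitionMatrix M π) = μ) (w : EuclideanSpace ℝ (Fin d)) :
    (1 - M.γ) * ∑ x, μ x * (inner ℝ (φ x) w) ^ 2 ≤ inner ℝ w (tdMap M π μ φ w) := by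
  have h1 := steadyMean_state (M := M) (π := π) (μ := μ) (fun x => (inner ℝ (φ x) w : ℝ) ^ 2)
  have h2 := steadyMean_next hμ (fun x => (inner ℝ (φ x) w : ℝ) ^ 2)
  have h3 : steadyMean M π μ (fun x _ x' => (1 - M.γ / 2) • (inner ℝ (φ x) w : ℝ) ^ 2 -
      (M.γ / 2) • (inner ℝ (φ x') w : ℝ) ^ 2) ≤ inner ℝ w (tdMap M π μ φ w) := by
    change _ ≤ inner ℝ w (steadyMean M π μ _)
    rw [inner_steadyMean]
    refine steadyMean_mono hμ0 fun x a x' _ => ?_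
    rw [inner_smul_right, real_inner_comm (φ x) w, smul_eq_mul, smul_eq_mul]
    nlinarith [mul_nonneg M.γ_pos.le (sq_nonneg ((inner ℝ (φ x) w : ℝ) - inner ℝ (φ x') w))]
  rw [steadyMean_sub (fun x _ _ => (1 - M.γ / 2) • (inner ℝ (φ x) w : ℝ) ^ 2),
    steadyMean_smul _ (fun x _ _ => (inner ℝ (φ x) w : ℝ) ^ 2),
    steadyMean_smul _ (fun _ _ x' => (inner ℝ (φ x') w : ℝ) ^ 2), h1, h2, smul_eq_mul,
    smul_eq_mul] at h3
  linarith

theorem existsUnique_isTDSolution (hμ0 : ∀ x, 0 < μ x)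
    (hμ : Matrix.vecMul μ (transitionMatrix M π) = μ) (hrank : (featureMatrix φ).rank = d) :
    ∃! w : EuclideanSpace ℝ (Fin d), IsTDSolution M π μ φ w := by
  have hinj : Function.Injective (tdMap M π μ φ) := by
    rw [injective_iff_map_eq_zero]
    intro w hw
    by_contra hne
    have h1 := le_inner_tdMap (φ := φ) (fun x => (hμ0 x).le) hμ w
    rw [hw, inner_zero_right] at h1
    have h2 := mul_pos (sub_pos.2 M.γ_lt_one) (sum_mul_inner_sq_pos hμ0 hrank hne)
    linarith
  have hbij : Function.Bijective (tdMap M π μ φ) :=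
    ⟨hinj, LinearMap.injective_iff_surjective.1 hinj⟩
  exact hbij.existsUnique _

/-- In the steady state the drift towards a solution of the temporal-difference equation is
strongly contracting. -/
theorem steadyMean_tdDrift_le (hμ0 : ∀ x, 0 ≤ μ x)
    (hμ : Matrix.vecMul μ (transitionMatrix M π) = μ) {v : EuclideanSpace ℝ (Fin d)}
    (hv : IsTDSolution M π μ φ v) (w : EuclideanSpace ℝ (Fin d)) :
    steadyMean M π μ (tdDrift M φ v w) ≤
      -((1 - M.γ) * ∑ x, μ x * (inner ℝ (φ x) (w - v)) ^ 2) := by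
  have h : steadyMean M π μ (tdDrift M φ v w) =
      inner ℝ (w - v) (steadyMean M π μ (fun x a _ => M.r x a • φ x) -
        steadyMean M π μ
          (fun x _ x' => (inner ℝ (φ x) v - M.γ * inner ℝ (φ x') v) • φ x) -
        tdMap M π μ φ (w - v)) := by
    change _ = inner ℝ (w - v) (_ - _ - steadyMean M π μ _)
    rw [← steadyMean_sub, ← steadyMean_sub, inner_steadyMean]
    congr 1
    funext x a x'
    rw [tdDrift, tdError_eq_add M φ x a x' w v, tdError, ← sub_smul, ← sub_smul, inner_smul_right,
      real_inner_comm (φ x) (w - v)]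
    ring
  have hv' : steadyMean M π μ (fun x _ x' => (inner ℝ (φ x) v - M.γ * inner ℝ (φ x') v) • φ x) =
      steadyMean M π μ (fun x a _ => M.r x a • φ x) := hv
  rw [h, hv', sub_self, zero_sub, inner_neg_right]
  exact neg_le_neg (le_inner_tdMap hμ0 hμ _)

end TD

/-! ### The Markov property of trajectories -/

/-- `Y` is a function of the history `x 0, a 0, …, a (k - 1), x k` of the trajectory up to
time `k`. -/
def IsHistoryFun {X A Ω V : Type*} (x : ℕ → Ω → X) (a : ℕ → Ω → A) (k : ℕ) (Y : Ω → V) : Prop :=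
  ∀ ω ω', (∀ i ≤ k, x i ω = x i ω') → (∀ i < k, a i ω = a i ω') → Y ω = Y ω'

section HistoryFun

variable {X A Ω V : Type*} {x : ℕ → Ω → X} {a : ℕ → Ω → A}

theorem IsHistoryFun.mono {k l : ℕ} {Y : Ω → V} (h : IsHistoryFun x a k Y) (hkl : k ≤ l) :
    IsHistoryFun x a l Y := fun ω ω' hx ha =>
  h ω ω' (fun i hi => hx i (hi.trans hkl)) fun i hi => ha i (hi.trans_le hkl)

theorem isHistoryFun_state {k n : ℕ} (h : n ≤ k) : IsHistoryFun x a k (x n) :=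
  fun _ _ hx _ => hx n h

theorem isHistoryFun_action {k n : ℕ} (h : n < k) : IsHistoryFun x a k (a n) :=
  fun _ _ _ ha => ha n h

theorem IsHistoryFun.comp {W : Type*} {k : ℕ} {Y : Ω → V} (h : IsHistoryFun x a k Y) (f : V → W) :
    IsHistoryFun x a k (fun ω => f (Y ω)) := fun ω ω' hx ha => congrArg f (h ω ω' hx ha)

theorem IsHistoryFun.comp₂ {W U : Type*} {k : ℕ} {Y : Ω → V} {Z : Ω → W}
    (hY : IsHistoryFun x a k Y) (hZ : IsHistoryFun x a k Z) (f : V → W → U) :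
    IsHistoryFun x a k (fun ω => f (Y ω) (Z ω)) := fun ω ω' hx ha =>
  congrArg₂ f (hY ω ω' hx ha) (hZ ω ω' hx ha)

theorem isHistoryFun_indicator_transition {V : Type*} [Zero V] [One V] (n : ℕ) (b : A) (y : X) :
    IsHistoryFun x a (n + 1) (Set.indicator {ω | a n ω = b ∧ x (n + 1) ω = y} (1 : Ω → V)) := by
  classical
  intro ω ω' hx ha
  simp only [Set.indicator_apply, Set.mem_ofPred_eq, hx (n + 1) le_rfl, ha n n.lt_succ_self,
    Pi.one_apply]

/-- The history of a trajectory up to time `k`. -/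
def history (x : ℕ → Ω → X) (a : ℕ → Ω → A) (k : ℕ) (ω : Ω) : (Fin (k + 1) → X) × (Fin k → A) :=
  (fun i => x i ω, fun i => a i ω)

theorem history_eq_iff {k : ℕ} {ω ω' : Ω} : history x a k ω = history x a k ω' ↔
    (∀ i ≤ k, x i ω = x i ω') ∧ ∀ i < k, a i ω = a i ω' := by
  simp only [history, Prod.mk.injEq, funext_iff, Fin.forall_iff, Nat.lt_succ_iff]

theorem IsHistoryFun.eq_of_history_eq {k : ℕ} {Y : Ω → V} (h : IsHistoryFun x a k Y) {ω ω' : Ω}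
    (hω : history x a k ω = history x a k ω') : Y ω = Y ω' :=
  h ω ω' (history_eq_iff.1 hω).1 (history_eq_iff.1 hω).2

end HistoryFun

section TransitionMean

variable {X A : Type*} [Fintype X] [Fintype A]

/-- The conditional mean of a function of one transition out of the state `z`. -/
def transitionMean (M : FiniteMDP X A) (π : Policy X A) (f : X → A → X → ℝ) (z : X) : ℝ :=
  ∑ b, ∑ z', π.prob z b * M.P z b z' * f z b z'

theorem steadyMean_eq_sum_transitionMean (M : FiniteMDP X A) (π : Policy X A)
    (μ : X → ℝ) (f : X → A → X → ℝ) :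
    steadyMean M π μ f = ∑ z, μ z * transitionMean M π f z := by
  simp only [steadyMean, transitionMean, Finset.mul_sum, smul_eq_mul, mul_assoc]

end TransitionMean

section Measurability

variable {X A Ω : Type*} [MeasurableSpace X] [MeasurableSpace A] [MeasurableSpace Ω]
  {ℙ : Measure Ω} {x : ℕ → Ω → X} {a : ℕ → Ω → A}

theorem measurable_history (hx : ∀ n, Measurable (x n)) (ha : ∀ n, Measurable (a n)) (k : ℕ) :
    Measurable (history x a k) := by
  unfold history
  fun_prop

variable [Fintype X] [Fintype A] {M : FiniteMDP X A} {π : Policy X A} {μ : X → ℝ}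

/-- One step of the Markov property, on a cell of the partition by histories. -/
theorem measureReal_history_inter (htraj : IsTrajectory M π μ ℙ x a) (n : ℕ) (b : A) (y : X)
    (ω₀ : Ω) :
    ℙ.real ({ω | a n ω = b ∧ x (n + 1) ω = y} ∩ history x a n ⁻¹' {history x a n ω₀}) =
      π.prob (x n ω₀) b * M.P (x n ω₀) b y *
        ℙ.real (history x a n ⁻¹' {history x a n ω₀}) := by
  classical
  have h0 : history x a n ⁻¹' {history x a n ω₀} =
      {ω | (∀ i ≤ n, x i ω = x i ω₀) ∧ ∀ i < n, a i ω = a i ω₀} := by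
    ext ω
    exact history_eq_iff
  set s : ℕ → X := Function.update (fun i => x i ω₀) (n + 1) y with hs
  set c : ℕ → A := Function.update (fun i => a i ω₀) n b with hc
  have hsi : ∀ i ≤ n, s i = x i ω₀ := fun i hi => Function.update_of_ne (by omega) _ _
  have hci : ∀ i < n, c i = a i ω₀ := fun i hi => Function.update_of_ne (by omega) _ _
  have hsn : s (n + 1) = y := Function.update_self _ _ _
  have hcn : c n = b := Function.update_self _ _ _
  have h1 : {ω | a n ω = b ∧ x (n + 1) ω = y} ∩ history x a n ⁻¹' {history x a n ω₀} =
      {ω | (∀ i ≤ n + 1, x i ω = s i) ∧ ∀ i < n + 1, a i ω = c i} := by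
    rw [h0]
    ext ω
    constructor
    · rintro ⟨⟨h1, h2⟩, h3, h4⟩
      refine ⟨fun i hi => ?_, fun i hi => ?_⟩
      · rcases Nat.lt_or_ge n i with h | h
        · obtain rfl : i = n + 1 := by omega
          rw [h2, hsn]
        · rw [h3 i h, hsi i h]
      · rcases Nat.lt_or_ge i n with h | h
        · rw [h4 i h, hci i h]
        · obtain rfl : i = n := by omega
          rw [h1, hcn]
    · rintro ⟨h1, h2⟩
      refine ⟨⟨by rw [h2 n (by omega), hcn], by rw [h1 (n + 1) le_rfl, hsn]⟩, fun i hi => ?_,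
        fun i hi => ?_⟩
      · rw [h1 i (by omega), hsi i hi]
      · rw [h2 i (by omega), hci i hi]
  rw [h1, h0, htraj.law (n + 1) s c, htraj.law n (fun i => x i ω₀) (fun i => a i ω₀),
    Finset.prod_range_succ, hsn, hcn, hsi n le_rfl, hsi 0 (Nat.zero_le _)]
  have : ∏ i ∈ Finset.range n, π.prob (s i) (c i) * M.P (s i) (c i) (s (i + 1)) =
      ∏ i ∈ Finset.range n, π.prob (x i ω₀) (a i ω₀) * M.P (x i ω₀) (a i ω₀) (x (i + 1) ω₀) := by
    refine Finset.prod_congr rfl fun i hi => ?_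
    have hi := Finset.mem_range.1 hi
    rw [hsi i hi.le, hci i hi, hsi (i + 1) hi]
  rw [this]; ring

theorem measureReal_initial_state [IsProbabilityMeasure ℙ] (htraj : IsTrajectory M π μ ℙ x a) (z : X) :
    ℙ.real {ω | x 0 ω = z} = μ z := by
  obtain ⟨ω₀⟩ := nonempty_of_isProbabilityMeasure ℙ
  have := htraj.law 0 (fun _ => z) (fun i => a i ω₀)
  simpa using this

end Measurability

section Markov

variable {X A : Type*} [Fintype X] [Fintype A]
  [MeasurableSpace X] [DiscreteMeasurableSpace X] [MeasurableSpace A] [DiscreteMeasurableSpace A]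
  {Ω : Type*} [MeasurableSpace Ω] {ℙ : Measure Ω} [IsProbabilityMeasure ℙ]
  {M : FiniteMDP X A} {π : Policy X A} {μ : X → ℝ} {x : ℕ → Ω → X} {a : ℕ → Ω → A}

theorem IsHistoryFun.integrable (htraj : IsTrajectory M π μ ℙ x a) {k : ℕ} {Y : Ω → ℝ}
    (h : IsHistoryFun x a k Y) : Integrable Y ℙ := by
  obtain ⟨F, hF⟩ : ∃ F : (Fin (k + 1) → X) × (Fin k → A) → ℝ, Y = F ∘ history x a k :=
    (Function.factorsThrough_iff _).1 fun ω ω' hω => h.eq_of_history_eq hω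
  have hm := measurable_history htraj.measurable_state htraj.measurable_action k
  have := Measure.isProbabilityMeasure_map (μ := ℙ) hm.aemeasurable
  rw [hF]
  exact (Integrable.of_finite (μ := ℙ.map (history x a k)) (f := F)).comp_measurable hm

theorem integral_mul_indicator_transition (htraj : IsTrajectory M π μ ℙ x a) {n : ℕ} {Y : Ω → ℝ}
    (hY : IsHistoryFun x a n Y) (b : A) (y : X) :
    ∫ ω, Y ω * Set.indicator {ω | a n ω = b ∧ x (n + 1) ω = y} 1 ω ∂ℙ =
      ∫ ω, Y ω * (π.prob (x n ω) b * M.P (x n ω) b y) ∂ℙ := by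
  have hm := measurable_history htraj.measurable_state htraj.measurable_action n
  have hB : MeasurableSet {ω | a n ω = b ∧ x (n + 1) ω = y} :=
    (htraj.measurable_action n (measurableSet_singleton b)).inter
      (htraj.measurable_state (n + 1) (measurableSet_singleton y))
  set B := {ω | a n ω = b ∧ x (n + 1) ω = y}
  have hsplit : ∀ Z : Ω → ℝ, Integrable Z ℙ →
      ∫ ω, Z ω ∂ℙ = ∑ t, ∫ ω in history x a n ⁻¹' {t}, Z ω ∂ℙ := by
    intro Z hZ
    rw [← integral_iUnion_fintype (fun t => hm (measurableSet_singleton t))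
      (fun t t' htt => Set.disjoint_left.2 fun ω h h' => htt (h.symm.trans h'))
      (fun t => hZ.integrableOn)]
    rw [← Set.preimage_iUnion, Set.iUnion_of_singleton, Set.preimage_univ, setIntegral_univ]
  have hq : IsHistoryFun x a n fun ω => π.prob (x n ω) b * M.P (x n ω) b y :=
    (isHistoryFun_state le_rfl).comp fun z => π.prob z b * M.P z b y
  rw [hsplit _ ?_, hsplit _ ((hY.comp₂ hq (· * ·)).integrable htraj)]
  · refine Finset.sum_congr rfl fun t _ => ?_
    rcases (history x a n ⁻¹' {t}).eq_empty_or_nonempty with h | ⟨ω₀, rfl⟩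
    · rw [h]; simp
    have hms : MeasurableSet (history x a n ⁻¹' {history x a n ω₀}) :=
      hm (measurableSet_singleton _)
    have h1 : ∫ ω in history x a n ⁻¹' {history x a n ω₀}, Y ω * B.indicator 1 ω ∂ℙ =
        ∫ ω in history x a n ⁻¹' {history x a n ω₀}, Y ω₀ * B.indicator 1 ω ∂ℙ :=
      setIntegral_congr_fun hms fun ω hω => by simp only [hY.eq_of_history_eq hω]
    have h2 : ∫ ω in history x a n ⁻¹' {history x a n ω₀},
          Y ω * (π.prob (x n ω) b * M.P (x n ω) b y) ∂ℙ =
        ∫ _ in history x a n ⁻¹' {history x a n ω₀},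
          Y ω₀ * (π.prob (x n ω₀) b * M.P (x n ω₀) b y) ∂ℙ :=
      setIntegral_congr_fun hms fun ω hω => by
        simp only [hY.eq_of_history_eq hω, isHistoryFun_state le_rfl |>.eq_of_history_eq hω]
    rw [h1, h2, integral_const_mul, integral_indicator_one hB, measureReal_restrict_apply hB,
      measureReal_history_inter htraj, setIntegral_const, smul_eq_mul]
    ring
  · exact ((hY.mono n.le_succ).comp₂ (isHistoryFun_indicator_transition n b y)
      (· * ·)).integrable htraj

/-- The Markov property for the state `n - k` steps ahead of the history. -/
theorem integral_mul_indicator_state [DecidableEq X] (htraj : IsTrajectory M π μ ℙ x a) {k l : ℕ}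
    {Y : Ω → ℝ} (hY : IsHistoryFun x a k Y) (y : X) :
    ∫ ω, Y ω * (if x (k + l) ω = y then 1 else 0) ∂ℙ =
      ∫ ω, Y ω * (transitionMatrix M π ^ l) (x k ω) y ∂ℙ := by
  induction l generalizing y with
  | zero => simp only [add_zero, pow_zero, Matrix.one_apply]
  | succ l ih =>
    have hYl := hY.mono (Nat.le_add_right k l)
    have hst : ∀ z : X, IsHistoryFun x a (k + l) fun ω => if x (k + l) ω = z then (1 : ℝ) else 0 :=
      fun z => (isHistoryFun_state le_rfl).comp fun u => if u = z then (1 : ℝ) else 0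
    have h1 : ∀ ω, Y ω * (if x (k + (l + 1)) ω = y then 1 else 0) =
        ∑ b, Y ω * Set.indicator {ω | a (k + l) ω = b ∧ x (k + l + 1) ω = y} 1 ω := by
      classical
      intro ω
      rw [← Finset.mul_sum]
      congr 1
      simp only [Set.indicator_apply, Set.mem_ofPred_eq, Pi.one_apply, ← add_assoc]
      by_cases h : x (k + l + 1) ω = y <;> simp [h]
    have h2 : ∀ ω, ∑ b, Y ω * (π.prob (x (k + l) ω) b * M.P (x (k + l) ω) b y) =
        ∑ z, transitionMatrix M π z y * (Y ω * (if x (k + l) ω = z then 1 else 0)) := by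
      intro ω
      simp only [mul_ite, mul_one, mul_zero, Finset.sum_ite_eq, Finset.mem_univ, if_true]
      simp only [transitionMatrix, Matrix.of_apply, Finset.sum_mul]
      exact Finset.sum_congr rfl fun b _ => by ring
    have h3 : ∀ ω, Y ω * (transitionMatrix M π ^ (l + 1)) (x k ω) y =
        ∑ z, transitionMatrix M π z y * (Y ω * (transitionMatrix M π ^ l) (x k ω) z) := by
      intro ω
      rw [pow_succ, Matrix.mul_apply, Finset.mul_sum]
      exact Finset.sum_congr rfl fun z _ => by ring
    simp_rw [h1, h3]
    rw [integral_finsetSum _ fun b _ => ?_, integral_finsetSum _ fun z _ => ?_]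
    · simp_rw [integral_mul_indicator_transition htraj hYl, integral_const_mul, ← ih]
      rw [← integral_finsetSum _ fun b _ => ?_]
      · simp_rw [h2]
        rw [integral_finsetSum _ fun z _ => ?_]
        · simp_rw [integral_const_mul]
        · exact ((hYl.comp₂ (hst z) (· * ·)).integrable htraj).const_mul _
      · exact (hYl.comp₂ ((isHistoryFun_state le_rfl).comp fun u => π.prob u b * M.P u b y)
          (· * ·)).integrable htraj
    · exact ((hY.comp₂ ((isHistoryFun_state le_rfl).comp
        fun u => (transitionMatrix M π ^ l) u z) (· * ·)).integrable htraj).const_mul _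
    · exact ((hYl.mono (Nat.le_succ _)).comp₂ (isHistoryFun_indicator_transition (k + l) b y)
        (· * ·)).integrable htraj

/-- The Markov property: the mean of a function of the history up to time `k` and of the
transition at time `k + l` is found by running the chain for `l` steps from the state at
time `k`. -/
theorem integral_transition [DecidableEq X] (htraj : IsTrajectory M π μ ℙ x a) {k : ℕ} (l : ℕ)
    {G : Ω → X → A → X → ℝ} (hG : IsHistoryFun x a k G) :
    ∫ ω, G ω (x (k + l) ω) (a (k + l) ω) (x (k + l + 1) ω) ∂ℙ =
      ∫ ω, ∑ z, (transitionMatrix M π ^ l) (x k ω) z * transitionMean M π (G ω) z ∂ℙ := by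
  have hGl := hG.mono (Nat.le_add_right k l)
  have hG1 : ∀ z b z', IsHistoryFun x a k fun ω => G ω z b z' := fun z b z' =>
    hG.comp fun g => g z b z'
  have hst : ∀ z : X, IsHistoryFun x a (k + l) fun ω => if x (k + l) ω = z then (1 : ℝ) else 0 :=
    fun z => (isHistoryFun_state le_rfl).comp fun u => if u = z then (1 : ℝ) else 0
  have hGst : ∀ z b z', IsHistoryFun x a (k + l) fun ω =>
      G ω z b z' * (if x (k + l) ω = z then (1 : ℝ) else 0) := fun z b z' =>
    ((hG1 z b z').mono (Nat.le_add_right k l)).comp₂ (hst z) (· * ·)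
  have h1 : ∀ ω, G ω (x (k + l) ω) (a (k + l) ω) (x (k + l + 1) ω) =
      ∑ z, ∑ b, ∑ z', G ω z b z' * (if x (k + l) ω = z then 1 else 0) *
        Set.indicator {ω | a (k + l) ω = b ∧ x (k + l + 1) ω = z'} 1 ω := by
    classical
    intro ω
    simp only [Set.indicator_apply, Set.mem_ofPred_eq, Pi.one_apply, ite_and, mul_ite, mul_one,
      mul_zero, Finset.sum_ite_eq, Finset.mem_univ, if_true, Finset.sum_ite_irrel,
      Finset.sum_const_zero]
  have h2 : ∀ z b z', ∫ ω, G ω z b z' * (if x (k + l) ω = z then 1 else 0) *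
        Set.indicator {ω | a (k + l) ω = b ∧ x (k + l + 1) ω = z'} 1 ω ∂ℙ =
      ∫ ω, (transitionMatrix M π ^ l) (x k ω) z * (π.prob z b * M.P z b z' * G ω z b z') ∂ℙ := by
    intro z b z'
    rw [integral_mul_indicator_transition htraj (hGst z b z')]
    have h3 : ∀ ω, G ω z b z' * (if x (k + l) ω = z then 1 else 0) *
        (π.prob (x (k + l) ω) b * M.P (x (k + l) ω) b z') =
        π.prob z b * M.P z b z' * (G ω z b z' * (if x (k + l) ω = z then 1 else 0)) := by
      intro ω
      by_cases h : x (k + l) ω = z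
      · simp only [h, if_true]; ring
      · simp only [h, if_false]; ring
    simp_rw [h3]
    rw [integral_const_mul, integral_mul_indicator_state htraj (hG1 z b z'),
      ← integral_const_mul]
    exact integral_congr_ae (ae_of_all _ fun ω => by ring)
  have hint1 : ∀ z b z', Integrable (fun ω => G ω z b z' *
      (if x (k + l) ω = z then 1 else 0) *
        Set.indicator {ω | a (k + l) ω = b ∧ x (k + l + 1) ω = z'} 1 ω) ℙ := fun z b z' =>
    (((hGst z b z').mono (Nat.le_succ _)).comp₂
      (isHistoryFun_indicator_transition (k + l) b z') (· * ·)).integrable htraj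
  have hint2 : ∀ z b z', Integrable (fun ω => (transitionMatrix M π ^ l) (x k ω) z *
      (π.prob z b * M.P z b z' * G ω z b z')) ℙ := fun z b z' =>
    (((isHistoryFun_state le_rfl).comp fun u => (transitionMatrix M π ^ l) u z).comp₂
      ((hG1 z b z').comp (π.prob z b * M.P z b z' * ·)) (· * ·)).integrable htraj
  simp_rw [h1, transitionMean, Finset.mul_sum]
  rw [integral_finsetSum _ fun z _ => integrable_finsetSum _ fun b _ =>
      integrable_finsetSum _ fun z' _ => hint1 z b z',
    integral_finsetSum _ fun z _ => integrable_finsetSum _ fun b _ =>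
      integrable_finsetSum _ fun z' _ => hint2 z b z']
  refine Finset.sum_congr rfl fun z _ => ?_
  rw [integral_finsetSum _ fun b _ => integrable_finsetSum _ fun z' _ => hint1 z b z',
    integral_finsetSum _ fun b _ => integrable_finsetSum _ fun z' _ => hint2 z b z']
  refine Finset.sum_congr rfl fun b _ => ?_
  rw [integral_finsetSum _ fun z' _ => hint1 z b z',
    integral_finsetSum _ fun z' _ => hint2 z b z']
  exact Finset.sum_congr rfl fun z' _ => h2 z b z'

/-- Along a stationary trajectory every transition has the steady-state law. -/
theorem integral_transition_eq_steadyMean [DecidableEq X] (htraj : IsTrajectory M π μ ℙ x a)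
    (hμ : Matrix.vecMul μ (transitionMatrix M π) = μ) (n : ℕ) (f : X → A → X → ℝ) :
    ∫ ω, f (x n ω) (a n ω) (x (n + 1) ω) ∂ℙ = steadyMean M π μ f := by
  have hf : IsHistoryFun x a 0 fun _ : Ω => f := fun _ _ _ _ => rfl
  have h1 := integral_transition htraj n hf
  simp only [zero_add] at h1
  set q : X → ℝ := fun u => ∑ z, (transitionMatrix M π ^ n) u z * transitionMean M π f z
  have h2 : ∫ ω, q (x 0 ω) ∂ℙ = ∑ u, μ u * q u := by
    have h3 : ∀ ω, q (x 0 ω) = ∑ u, Set.indicator {ω | x 0 ω = u} (fun _ => q u) ω := by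
      classical
      intro ω
      simp [Set.indicator_apply]
    have hms : ∀ u, MeasurableSet {ω | x 0 ω = u} := fun u =>
      htraj.measurable_state 0 (measurableSet_singleton u)
    simp_rw [h3]
    rw [integral_finsetSum _ fun u _ => (integrable_const (q u)).indicator (hms u)]
    refine Finset.sum_congr rfl fun u _ => ?_
    rw [integral_indicator_const _ (hms u), measureReal_initial_state htraj, smul_eq_mul]
  rw [h1, h2, steadyMean_eq_sum_transitionMean]
  simp_rw [q, Finset.mul_sum]
  rw [Finset.sum_comm]
  refine Finset.sum_congr rfl fun z _ => ?_
  have := congrFun (vecMul_pow_eq hμ n) z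
  simp only [Matrix.vecMul, dotProduct] at this
  rw [← this, Finset.sum_mul]
  exact Finset.sum_congr rfl fun u _ => (mul_assoc _ _ _).symm

end Markov

/-! ### Pathwise estimates for one projected implicit step -/

section Projection

variable {d : ℕ} {R : ℝ}

theorem projBall_of_norm_le {w : EuclideanSpace ℝ (Fin d)} (h : ‖w‖ ≤ R) : projBall R w = w :=
  if_neg (not_lt.2 h)

theorem norm_projBall_le (hR : 0 ≤ R) (w : EuclideanSpace ℝ (Fin d)) : ‖projBall R w‖ ≤ R := by
  unfold projBall
  split_ifs with h
  · have hw : 0 < ‖w‖ := hR.trans_lt h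
    rw [norm_smul, norm_div, norm_norm, Real.norm_of_nonneg hR, div_mul_cancel₀ _ hw.ne']
  · exact not_lt.1 h

theorem inner_sub_projBall_le_zero (hR : 0 ≤ R) (w : EuclideanSpace ℝ (Fin d))
    {v : EuclideanSpace ℝ (Fin d)} (hv : ‖v‖ ≤ R) :
    inner ℝ (w - projBall R w) (v - projBall R w) ≤ 0 := by
  unfold projBall
  split_ifs with h
  · have hw : 0 < ‖w‖ := hR.trans_lt h
    have h1 : w - (R / ‖w‖) • w = (1 - R / ‖w‖) • w := by rw [sub_smul, one_smul]
    rw [h1, inner_smul_left, inner_sub_right, inner_smul_right, real_inner_self_eq_norm_sq]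
    have h2 : R / ‖w‖ * ‖w‖ ^ 2 = R * ‖w‖ := by field_simp
    have h3 : inner ℝ w v ≤ R * ‖w‖ :=
      (real_inner_le_norm w v).trans (by rw [mul_comm]; gcongr)
    have h4 : R / ‖w‖ ≤ 1 := (div_le_one hw).2 h.le
    simp only [conj_trivial]
    rw [h2]
    exact mul_nonpos_of_nonneg_of_nonpos (by linarith) (by linarith)
  · simp

/-- Projection onto the ball is nonexpansive. -/
theorem norm_projBall_sub_projBall_le (hR : 0 ≤ R) (w v : EuclideanSpace ℝ (Fin d)) :
    ‖projBall R w - projBall R v‖ ≤ ‖w - v‖ := by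
  have h1 := inner_sub_projBall_le_zero hR w (norm_projBall_le hR v)
  have h2 := inner_sub_projBall_le_zero hR v (norm_projBall_le hR w)
  have h3 : ‖projBall R w - projBall R v‖ ^ 2 ≤ ‖w - v‖ * ‖projBall R w - projBall R v‖ := by
    refine le_trans ?_ (real_inner_le_norm (w - v) (projBall R w - projBall R v))
    rw [← real_inner_self_eq_norm_sq]
    simp only [inner_sub_left, inner_sub_right] at h1 h2 ⊢
    linarith [real_inner_comm (projBall R w) (projBall R v)]
  rcases (norm_nonneg (projBall R w - projBall R v)).eq_or_lt with h | h
  · rw [← h]; exact norm_nonneg _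
  · exact le_of_mul_le_mul_right (by rwa [sq] at h3) h

theorem norm_projBall_sub_le {w v : EuclideanSpace ℝ (Fin d)} (hv : ‖v‖ ≤ R) :
    ‖projBall R w - v‖ ≤ ‖w - v‖ := by
  have h := norm_projBall_sub_projBall_le ((norm_nonneg v).trans hv) w v
  rwa [projBall_of_norm_le hv] at h

end Projection

section Step

variable {X A : Type*} [Fintype X] {d : ℕ} {M : FiniteMDP X A}
  {φ : X → EuclideanSpace ℝ (Fin d)} {rmax R α : ℝ}

theorem abs_inner_le_of_norm_le_one {v w : EuclideanSpace ℝ (Fin d)} (hv : ‖v‖ ≤ 1) :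
    |(inner ℝ v w : ℝ)| ≤ ‖w‖ :=
  (abs_real_inner_le_norm v w).trans (mul_le_of_le_one_left (norm_nonneg w) hv)

theorem abs_tdError_le (hφ : ∀ z, ‖φ z‖ ≤ 1) {z : X} {b : A} (z' : X) (hr : |M.r z b| ≤ rmax)
    (w : EuclideanSpace ℝ (Fin d)) : |tdError M φ z b z' w| ≤ rmax + 2 * ‖w‖ := by
  have h1 := abs_le.1 (abs_inner_le_of_norm_le_one (w := w) (hφ z))
  have h2 := abs_inner_le_of_norm_le_one (w := w) (hφ z')
  have h3 : |M.γ * (inner ℝ (φ z') w : ℝ)| ≤ ‖w‖ := by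
    rw [abs_mul, abs_of_pos M.γ_pos]
    exact (mul_le_of_le_one_left (abs_nonneg _) M.γ_lt_one.le).trans h2
  have h3 := abs_le.1 h3
  have h4 := abs_le.1 hr
  rw [tdError, abs_le]
  constructor <;> linarith

theorem abs_tdError_sub_le (hφ : ∀ z, ‖φ z‖ ≤ 1) (z : X) (b : A) (z' : X)
    (w u : EuclideanSpace ℝ (Fin d)) :
    |tdError M φ z b z' w - tdError M φ z b z' u| ≤ 2 * ‖w - u‖ := by
  have h1 := abs_le.1 (abs_inner_le_of_norm_le_one (w := w - u) (hφ z))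
  have h2 := abs_inner_le_of_norm_le_one (w := w - u) (hφ z')
  have h3 : |M.γ * (inner ℝ (φ z') (w - u) : ℝ)| ≤ ‖w - u‖ := by
    rw [abs_mul, abs_of_pos M.γ_pos]
    exact (mul_le_of_le_one_left (abs_nonneg _) M.γ_lt_one.le).trans h2
  have h3 := abs_le.1 h3
  rw [tdError_eq_add M φ z b z' w u, abs_le]
  constructor <;> linarith

theorem abs_tdDrift_le (hrmax : 0 < rmax) (hφ : ∀ z, ‖φ z‖ ≤ 1) {z : X} {b : A} (z' : X)
    (hr : |M.r z b| ≤ rmax) {v w : EuclideanSpace ℝ (Fin d)} (hv : ‖v‖ ≤ R) (hw : ‖w‖ ≤ R) :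
    |tdDrift M φ v w z b z'| ≤ (rmax + 2 * R) ^ 2 := by
  have h1 := abs_tdError_le hφ z' hr w
  have h2 := (abs_inner_le_of_norm_le_one (w := w - v) (hφ z)).trans (norm_sub_le w v)
  have hR := (norm_nonneg v).trans hv
  rw [tdDrift, abs_mul, sq]
  exact mul_le_mul (by linarith) (by linarith) (abs_nonneg _) (by linarith)

theorem abs_tdDrift_sub_le (hrmax : 0 < rmax) (hφ : ∀ z, ‖φ z‖ ≤ 1) {z : X} {b : A} (z' : X)
    (hr : |M.r z b| ≤ rmax) {v w u : EuclideanSpace ℝ (Fin d)} (hv : ‖v‖ ≤ R) (hw : ‖w‖ ≤ R)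
    (hu : ‖u‖ ≤ R) :
    |tdDrift M φ v w z b z' - tdDrift M φ v u z b z'| ≤ 3 * (rmax + 2 * R) * ‖w - u‖ := by
  have h1 := abs_tdError_le hφ z' hr w
  have h2 := abs_inner_le_of_norm_le_one (w := w - u) (hφ z)
  have h3 := (abs_inner_le_of_norm_le_one (w := u - v) (hφ z)).trans (norm_sub_le u v)
  have h4 := abs_tdError_sub_le (M := M) hφ z b z' w u
  have hR := (norm_nonneg v).trans hv
  have h5 : tdDrift M φ v w z b z' - tdDrift M φ v u z b z' =
      tdError M φ z b z' w * inner ℝ (φ z) (w - u) +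
        (tdError M φ z b z' w - tdError M φ z b z' u) * inner ℝ (φ z) (u - v) := by
    simp only [tdDrift, inner_sub_right]; ring
  rw [h5]
  refine (abs_add_le _ _).trans ?_
  rw [abs_mul, abs_mul]
  have h6 : |tdError M φ z b z' w| * |(inner ℝ (φ z) (w - u) : ℝ)| ≤
      (rmax + 2 * R) * ‖w - u‖ :=
    mul_le_mul (by linarith) h2 (abs_nonneg _) (by linarith)
  have h7 : |tdError M φ z b z' w - tdError M φ z b z' u| * |(inner ℝ (φ z) (u - v) : ℝ)| ≤
      2 * ‖w - u‖ * (rmax + 2 * R) :=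
    mul_le_mul h4 (by linarith) (abs_nonneg _) (by positivity)
  linarith

theorem implicitStep_eq (x : X) (a : A) (x' : X) (w : EuclideanSpace ℝ (Fin d)) :
    implicitStep M φ α x a x' w =
      w + (α / (1 + α * ‖φ x‖ ^ 2) * tdError M φ x a x' w) • φ x := by
  rw [implicitStep, smul_smul]; rfl

theorem norm_implicitStep_sub_self_le (hα : 0 < α) (hφ : ∀ z, ‖φ z‖ ≤ 1) {z : X} {b : A} (z' : X)
    (hr : |M.r z b| ≤ rmax) (w : EuclideanSpace ℝ (Fin d)) :
    ‖implicitStep M φ α z b z' w - w‖ ≤ α * (rmax + 2 * ‖w‖) := by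
  have h1 := abs_tdError_le hφ z' hr w
  have h2 : α / (1 + α * ‖φ z‖ ^ 2) ≤ α := div_le_self hα.le (by nlinarith [sq_nonneg ‖φ z‖])
  rw [implicitStep_eq, add_sub_cancel_left, norm_smul, norm_mul, Real.norm_eq_abs,
    Real.norm_eq_abs, abs_of_nonneg (by positivity)]
  calc α / (1 + α * ‖φ z‖ ^ 2) * |tdError M φ z b z' w| * ‖φ z‖
      ≤ α * |tdError M φ z b z' w| * 1 := by gcongr; exact hφ z
    _ ≤ α * (rmax + 2 * ‖w‖) := by rw [mul_one]; gcongr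

/-- One step changes the squared distance to `v` by the drift at the nominal step size `α`, up to
terms of order `α ^ 2`; these include the price of replacing the effective step size
`α / (1 + α ‖φ‖ ^ 2)`, which depends on the state, by `α`. -/
theorem norm_projBall_implicitStep_sub_sq_le (hα : 0 < α) (hφ : ∀ z, ‖φ z‖ ≤ 1) (z : X) (b : A)
    (z' : X) {v : EuclideanSpace ℝ (Fin d)} (hv : ‖v‖ ≤ R) (w : EuclideanSpace ℝ (Fin d)) :
    ‖projBall R (implicitStep M φ α z b z' w) - v‖ ^ 2 ≤ ‖w - v‖ ^ 2 +
      2 * α * tdDrift M φ v w z b z' + α ^ 2 * (|tdError M φ z b z' w| ^ 2 +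
        2 * |tdError M φ z b z' w| * ‖w - v‖) := by
  have h1 : ‖projBall R (implicitStep M φ α z b z' w) - v‖ ^ 2 ≤
      ‖implicitStep M φ α z b z' w - v‖ ^ 2 := by
    gcongr
    exact norm_projBall_sub_le hv
  refine h1.trans ?_
  have h2 := abs_inner_le_of_norm_le_one (w := w - v) (hφ z)
  rw [implicitStep_eq, tdDrift]
  set D := tdError M φ z b z' w
  set s := ‖φ z‖ ^ 2 with hs
  have hs0 : 0 ≤ s := sq_nonneg _
  have hs1 : s ≤ 1 := pow_le_one₀ (norm_nonneg _) (hφ z)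
  have hpos : 0 < 1 + α * s := by positivity
  set η := α / (1 + α * s) with hη
  have hη0 : 0 ≤ η := by positivity
  have hη1 : η ≤ α := div_le_self hα.le (by nlinarith)
  have hη2 : α - η ≤ α ^ 2 := by
    have : α - η = η * (α * s) := by rw [hη]; field_simp; ring
    rw [this, sq]
    exact mul_le_mul hη1 (mul_le_of_le_one_right hα.le hs1) (by positivity) hα.le
  have h3 : w + (η * D) • φ z - v = (w - v) + (η * D) • φ z := by abel
  rw [h3, norm_add_sq_real, inner_smul_right, norm_smul, mul_pow, Real.norm_eq_abs, sq_abs,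
    ← hs, real_inner_comm (φ z) (w - v)]
  set q : ℝ := inner ℝ (φ z) (w - v)
  have h4 : (η * D) ^ 2 * s ≤ α ^ 2 * |D| ^ 2 := by
    rw [sq_abs, mul_pow]
    calc η ^ 2 * D ^ 2 * s ≤ η ^ 2 * D ^ 2 * 1 := by gcongr
      _ ≤ α ^ 2 * D ^ 2 := by rw [mul_one]; gcongr
  have h5 : -((α - η) * (D * q)) ≤ α ^ 2 * (|D| * ‖w - v‖) := by
    have h6 : -(D * q) ≤ |D| * ‖w - v‖ := by
      refine (neg_le_abs _).trans ?_
      rw [abs_mul]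
      gcongr
    calc -((α - η) * (D * q)) = (α - η) * -(D * q) := by ring
      _ ≤ (α - η) * (|D| * ‖w - v‖) := mul_le_mul_of_nonneg_left h6 (by linarith)
      _ ≤ α ^ 2 * (|D| * ‖w - v‖) := by gcongr
  have h7 : 2 * (η * D * q) = 2 * α * (D * q) - 2 * ((α - η) * (D * q)) := by ring
  linarith

theorem norm_projImplicitTD0_le (hR : 0 ≤ R) (w₁ : EuclideanSpace ℝ (Fin d)) (x : ℕ → X)
    (a : ℕ → A) {n : ℕ} (hn : 1 ≤ n) : ‖projImplicitTD0 M φ α R w₁ x a n‖ ≤ R := by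
  obtain ⟨n, rfl⟩ := Nat.exists_eq_add_of_le' hn
  exact norm_projBall_le hR _

/-- Once inside the ball, the iterates move by at most `α G` per step. -/
theorem norm_projImplicitTD0_add_sub_le (hα : 0 < α) (hR : 0 ≤ R)
    (hφ : ∀ z, ‖φ z‖ ≤ 1) (w₁ : EuclideanSpace ℝ (Fin d)) {x : ℕ → X} {a : ℕ → A}
    (hr : ∀ n, |M.r (x n) (a n)| ≤ rmax) {k : ℕ} (hk : 1 ≤ k) (l : ℕ) :
    ‖projImplicitTD0 M φ α R w₁ x a (k + l) - projImplicitTD0 M φ α R w₁ x a k‖ ≤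
      l * (α * (rmax + 2 * R)) := by
  induction l with
  | zero => simp
  | succ l ih =>
    have h1 := norm_projImplicitTD0_le (M := M) (φ := φ) (α := α) hR w₁ x a
      (hk.trans (Nat.le_add_right k l))
    have h2 := (norm_projBall_sub_le (w := implicitStep M φ α (x (k + l)) (a (k + l))
      (x (k + l + 1)) (projImplicitTD0 M φ α R w₁ x a (k + l))) h1).trans
      (norm_implicitStep_sub_self_le hα hφ _ (hr _) _)
    have h3 := norm_sub_le_norm_sub_add_norm_sub (projImplicitTD0 M φ α R w₁ x a (k + l + 1))
      (projImplicitTD0 M φ α R w₁ x a (k + l)) (projImplicitTD0 M φ α R w₁ x a k)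
    rw [← add_assoc]
    have h4 : α * (rmax + 2 * ‖projImplicitTD0 M φ α R w₁ x a (k + l)‖) ≤
        α * (rmax + 2 * R) := by gcongr
    push_cast
    change ‖projImplicitTD0 M φ α R w₁ x a (k + l + 1) - _‖ ≤ _ at h2
    linarith

/-- The initial guess may lie outside the ball, and then the first step is compared with the
projection of the initial guess. -/
theorem norm_projImplicitTD0_one_sub_le (hα : 0 < α) (hφ : ∀ z, ‖φ z‖ ≤ 1)
    {v : EuclideanSpace ℝ (Fin d)} (hv : ‖v‖ ≤ R) (w₁ : EuclideanSpace ℝ (Fin d)) {x : ℕ → X}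
    {a : ℕ → A} (hr : ∀ n, |M.r (x n) (a n)| ≤ rmax) :
    ‖projImplicitTD0 M φ α R w₁ x a 1 - projBall R w₁‖ ≤
      α * (rmax + 2 * R + 2 * ‖w₁ - v‖) := by
  have h1 := (norm_projBall_sub_projBall_le ((norm_nonneg v).trans hv)
    (implicitStep M φ α (x 0) (a 0) (x 1) w₁) w₁).trans
    (norm_implicitStep_sub_self_le hα hφ _ (hr 0) _)
  have h2 := norm_le_norm_sub_add w₁ v
  exact h1.trans (mul_le_mul_of_nonneg_left (by linarith) hα.le)

end Step

/-! ### The scalar recursion -/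

theorem six_mul_le_of_mul_lt_one {α t : ℝ} (hα : 0 < α) (ht : 0 ≤ t)
    (h : α * (1 + α) * (9 / 2 + 6 * t) < 1) : 6 * α * (t + 1) ≤ 1 + α := by
  have hα1 : α < 1 := by
    by_contra! h1
    nlinarith only [h, h1, mul_nonneg (mul_nonneg hα.le (by linarith : 0 ≤ 1 + α)) ht]
  have h4 : α * (9 / 2 + 6 * t) * (1 + α) ≤ (1 - α / 2) * (1 + α) := by
    nlinarith only [h, hα, hα1]
  have h5 := le_of_mul_le_mul_right h4 (by linarith)
  linarith

/-- Solving the recursion for the mean squared error `V`. The per-step error during the first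
`τ + 1` steps may exceed `(1 - β) B`, because the initial distance `E` is arbitrary. Either
`G ^ 2`, which bounds `V n` for `n ≥ 1`, is already below the target, or `α` is so small compared
with `1 / τ`, and `E` with `G`, that the errors of these steps add up to at most `B`. -/
theorem le_of_recursion {V : ℕ → ℝ} {α c G E B β : ℝ} {τ : ℕ} (hα : 0 < α) (hc : 0 < c)
    (hc1 : c ≤ 1) (hG : 0 < G) (hstep : 2 * α * c < 1 + α)
    (hβ : β = 1 - 2 * α * c / (1 + α))
    (hB : B = α * (1 + α) * G ^ 2 * (9 + 12 * τ) / (2 * c))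
    (hV0 : V 0 = E ^ 2) (hVG : ∀ n, 1 ≤ n → V n ≤ G ^ 2)
    (hV1 : V 1 ≤ β * V 0 + α ^ 2 * (G ^ 2 + 6 * G * E + 8 * E ^ 2))
    (hVinit : ∀ n : ℕ, n < τ →
      V (n + 2) ≤ β * V (n + 1) + α ^ 2 * (3 * G ^ 2 + 12 * G * (G + 2 * E + n * G)))
    (hVmix : ∀ n, τ + 1 ≤ n → V (n + 1) ≤ β * V n + α ^ 2 * G ^ 2 * (7 + 12 * τ)) (N : ℕ) :
    V N ≤ β ^ N * E ^ 2 + B := by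
  have h1α : 0 < 1 + α := by linarith
  have hβ0 : 0 ≤ β := by
    rw [hβ, sub_nonneg, div_le_one h1α]; exact hstep.le
  have hβ1 : β ≤ 1 := by
    rw [hβ]; linarith [show 0 ≤ 2 * α * c / (1 + α) by positivity]
  have hτ0 : (0 : ℝ) ≤ τ := Nat.cast_nonneg τ
  have hB0 : 0 ≤ B := by rw [hB]; positivity
  have hBC : (1 - β) * B = α ^ 2 * G ^ 2 * (9 + 12 * τ) := by
    rw [hβ, hB]; field_simp; ring
  -- the bound is linear in `α`, hence dominates many errors of order `α ^ 2`
  have hBlow : α * (1 + α) * G ^ 2 * (9 / 2 + 6 * τ) ≤ B := by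
    rw [hB, le_div_iff₀ (by positivity)]
    have : 0 ≤ α * (1 + α) * G ^ 2 * (9 + 12 * τ) := by positivity
    nlinarith
  have hinit : ∀ N, 1 ≤ N → N ≤ τ + 1 → V N ≤ β ^ N * E ^ 2 + B := by
    intro N hN hNτ
    by_contra! hlt
    have h1 := hlt.trans_le (hVG N hN)
    have hEN : 0 ≤ β ^ N * E ^ 2 := by positivity
    have h2 : α * (1 + α) * (9 / 2 + 6 * τ) < 1 := by
      have h3 : α * (1 + α) * (9 / 2 + 6 * τ) * G ^ 2 < 1 * G ^ 2 := by linarith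
      exact lt_of_mul_lt_mul_right h3 (by positivity)
    -- the target is below `G ^ 2`, hence so is `B`; this bounds `α (τ + 1)`
    have h3 := six_mul_le_of_mul_lt_one hα hτ0 h2
    have hNle : (N : ℝ) ≤ τ + 1 := by exact_mod_cast hNτ
    have hβN : 2 / 3 ≤ β ^ N := by
      have h4 := one_add_mul_le_pow (a := -(2 * α * c / (1 + α))) (by
        have : 2 * α * c / (1 + α) ≤ 1 := (div_le_one h1α).2 hstep.le
        linarith) N
      have h5 : (N : ℝ) * (2 * α * c / (1 + α)) ≤ 1 / 3 := by
        rw [← mul_div_assoc, div_le_iff₀ h1α]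
        have h6 : (N : ℝ) * (2 * α * c) ≤ (τ + 1) * (2 * α * 1) := by gcongr
        linarith
      rw [hβ, sub_eq_add_neg]
      linarith
    have hE2 : E ^ 2 ≤ 3 / 2 * G ^ 2 := by
      nlinarith only [hβN, hB0, h1, sq_nonneg E]
    have hE1 : E ≤ 5 / 4 * G := by
      refine le_of_sq_le_sq ?_ (by positivity)
      nlinarith only [hE2, sq_nonneg G]
    -- from `E ≤ 5 / 4 * G`, the first step costs `21 α ^ 2 G ^ 2`, each later one at most
    -- `(33 + 12 τ) α ^ 2 G ^ 2`
    have hunroll : ∀ n : ℕ, n ≤ τ →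
        V (n + 1) ≤ β ^ (n + 1) * E ^ 2 + α ^ 2 * G ^ 2 * (21 + n * (33 + 12 * τ)) := by
      intro n
      induction n with
      | zero =>
        intro _
        have h6 : G ^ 2 + 6 * G * E + 8 * E ^ 2 ≤ G ^ 2 * 21 := by
          nlinarith only [hE2, mul_le_mul_of_nonneg_left hE1 hG.le, sq_nonneg G]
        have h7 := mul_le_mul_of_nonneg_left h6 (sq_nonneg α)
        rw [hV0] at hV1
        simp only [zero_add, pow_one, Nat.cast_zero, zero_mul, add_zero]
        linarith only [h7, hV1]
      | succ n ih =>
        intro hn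
        have h4 := ih (by omega)
        have h5 := hVinit n (by omega)
        have hnτ : (n : ℝ) + 1 ≤ τ := by exact_mod_cast hn
        have h6 : 3 * G ^ 2 + 12 * G * (G + 2 * E + n * G) ≤ G ^ 2 * (33 + 12 * τ) := by
          nlinarith only [mul_le_mul_of_nonneg_left hE1 hG.le,
            mul_le_mul_of_nonneg_left hnτ (sq_nonneg G)]
        have h7 := mul_le_mul_of_nonneg_left h6 (sq_nonneg α)
        have h8 := mul_le_mul_of_nonneg_left h4 hβ0
        have h9 : β * (α ^ 2 * G ^ 2 * (21 + n * (33 + 12 * τ))) ≤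
            α ^ 2 * G ^ 2 * (21 + n * (33 + 12 * τ)) :=
          mul_le_of_le_one_left (by positivity) hβ1
        rw [pow_succ β (n + 1)]
        push_cast
        linarith only [h5, h7, h8, h9]
    obtain ⟨n, rfl⟩ := Nat.exists_eq_add_of_le' hN
    have h4 := hunroll n (by omega)
    have hnτ : (n : ℝ) ≤ τ := by exact_mod_cast (by omega : n ≤ τ)
    have h5 : α * (21 + n * (33 + 12 * τ)) ≤ (1 + α) * (9 / 2 + 6 * τ) := by
      have h6 : α * (21 + n * (33 + 12 * τ)) ≤ α * (6 * (τ + 1) * (9 / 2 + 6 * τ)) := by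
        gcongr
        nlinarith only [hτ0, sq_nonneg (τ : ℝ), mul_le_mul_of_nonneg_right hnτ (by positivity : (0 : ℝ) ≤ 33 + 12 * τ)]
      have h7 := mul_le_mul_of_nonneg_right h3 (by positivity : (0 : ℝ) ≤ 9 / 2 + 6 * τ)
      linarith
    have h6 := mul_le_mul_of_nonneg_left h5 (by positivity : 0 ≤ α * G ^ 2)
    linarith only [hlt, h4, h6, hBlow]
  have hlate : ∀ n, V (τ + 1 + n) ≤ β ^ (τ + 1 + n) * E ^ 2 + B := by
    intro n
    induction n with
    | zero => exact hinit (τ + 1) (by omega) le_rfl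
    | succ n ih =>
      have h1 := hVmix (τ + 1 + n) (by omega)
      have h2 := mul_le_mul_of_nonneg_left ih hβ0
      have h3 : 0 ≤ α ^ 2 * G ^ 2 := by positivity
      rw [← add_assoc, pow_succ β]
      linarith only [h1, h2, h3, hBC]
  rcases Nat.eq_zero_or_pos N with rfl | hN
  · rw [hV0, pow_zero, one_mul]; linarith
  rcases Nat.le_total N (τ + 1) with h | h
  · exact hinit N hN h
  · obtain ⟨n, rfl⟩ := Nat.exists_eq_add_of_le h
    exact hlate n

/-! ### Mean drift along the trajectory -/

section Iterates

variable {X A : Type*} [Fintype X] {d : ℕ}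

theorem isHistoryFun_projImplicitTD0 {Ω : Type*} (M : FiniteMDP X A)
    (φ : X → EuclideanSpace ℝ (Fin d)) (α R : ℝ) (w₁ : EuclideanSpace ℝ (Fin d)) (x : ℕ → Ω → X)
    (a : ℕ → Ω → A) (n : ℕ) : IsHistoryFun x a n
      (fun ω => projImplicitTD0 M φ α R w₁ (fun n => x n ω) (fun n => a n ω) n) := by
  induction n with
  | zero => exact fun _ _ _ _ => rfl
  | succ n ih =>
    intro ω ω' hx ha
    have h : projImplicitTD0 M φ α R w₁ (fun n => x n ω) (fun n => a n ω) n =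
        projImplicitTD0 M φ α R w₁ (fun n => x n ω') (fun n => a n ω') n :=
      ih.mono n.le_succ ω ω' hx ha
    simp only [projImplicitTD0]
    rw [h, hx n n.le_succ, hx (n + 1) le_rfl, ha n n.lt_succ_self]

end Iterates

section MeanDrift

variable {X A : Type*} [Fintype X] [Fintype A] {d : ℕ} {M : FiniteMDP X A} {π : Policy X A}
  {μ : X → ℝ} {φ : X → EuclideanSpace ℝ (Fin d)} {rmax R : ℝ}

theorem abs_transitionMean_le {f : X → A → X → ℝ} {C : ℝ} {z : X}
    (h : ∀ b z', π.prob z b ≠ 0 → |f z b z'| ≤ C) : |transitionMean M π f z| ≤ C := by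
  have h1 : |transitionMean M π f z| ≤ ∑ b, ∑ z', π.prob z b * M.P z b z' * C := by
    refine (Finset.abs_sum_le_sum_abs _ _).trans (Finset.sum_le_sum fun b _ => ?_)
    refine (Finset.abs_sum_le_sum_abs _ _).trans (Finset.sum_le_sum fun z' _ => ?_)
    have h0 := mul_nonneg (π.prob_nonneg z b) (M.P_nonneg z b z')
    rw [abs_mul, abs_of_nonneg h0]
    by_cases hb : π.prob z b = 0
    · simp [hb]
    · exact mul_le_mul_of_nonneg_left (h b z' hb) h0
  refine h1.trans_eq ?_
  simp_rw [← Finset.sum_mul, ← Finset.mul_sum, M.P_sum, mul_one, π.prob_sum, one_mul]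

/-- The steady-state drift is Lipschitz on the ball. -/
theorem steadyMean_tdDrift_le_add (hμ0 : ∀ z, 0 ≤ μ z) (hμ1 : ∑ z, μ z = 1) (hrmax : 0 < rmax)
    (hφ : ∀ z, ‖φ z‖ ≤ 1) (hr : ∀ z b, π.prob z b ≠ 0 → |M.r z b| ≤ rmax)
    {v w u : EuclideanSpace ℝ (Fin d)} (hv : ‖v‖ ≤ R) (hw : ‖w‖ ≤ R) (hu : ‖u‖ ≤ R) :
    steadyMean M π μ (tdDrift M φ v u) ≤
      steadyMean M π μ (tdDrift M φ v w) + 3 * (rmax + 2 * R) * ‖w - u‖ := by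
  have h1 : steadyMean M π μ (fun _ _ _ => 3 * (rmax + 2 * R) * ‖w - u‖) =
      3 * (rmax + 2 * R) * ‖w - u‖ := by
    rw [steadyMean_state (fun _ => 3 * (rmax + 2 * R) * ‖w - u‖), ← Finset.sum_mul, hμ1, one_mul]
  rw [← h1, ← steadyMean_add]
  refine steadyMean_mono hμ0 fun z b z' hb => ?_
  have := (abs_le.1 (abs_tdDrift_sub_le hrmax hφ z' (hr z b hb) hv hw hu)).1
  linarith

variable [MeasurableSpace X] [DiscreteMeasurableSpace X] [MeasurableSpace A]
  [DiscreteMeasurableSpace A] {Ω : Type*} [MeasurableSpace Ω] {ℙ : Measure Ω}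
  [IsProbabilityMeasure ℙ] {x : ℕ → Ω → X} {a : ℕ → Ω → A}

/-- Every state-action pair in the support of the policy is visited with positive probability at
time `0`. -/
theorem forall_of_ae_initial [DecidableEq X] (htraj : IsTrajectory M π μ ℙ x a)
    (hμ0 : ∀ z, 0 < μ z) (hμ : Matrix.vecMul μ (transitionMatrix M π) = μ) {p : X → A → Prop}
    (h : ∀ᵐ ω ∂ℙ, p (x 0 ω) (a 0 ω)) (z : X) (b : A) (hb : π.prob z b ≠ 0) : p z b := by
  classical
  set f : X → A → X → ℝ := fun z b _ => if p z b then 0 else 1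
  have h1 := integral_transition_eq_steadyMean htraj hμ 0 f
  rw [integral_eq_zero_of_ae (h.mono fun ω hω => by simp [f, hω])] at h1
  simp only [steadyMean, smul_eq_mul] at h1
  have hnn : ∀ z b z', 0 ≤ μ z * π.prob z b * M.P z b z' * f z b z' := fun z b z' =>
    mul_nonneg (mul_nonneg (mul_nonneg (hμ0 z).le (π.prob_nonneg _ _)) (M.P_nonneg _ _ _))
      (by simp only [f]; split_ifs <;> simp)
  have h2 := (Finset.sum_eq_zero_iff_of_nonneg fun z _ => Finset.sum_nonneg fun b _ =>
    Finset.sum_nonneg fun z' _ => hnn z b z').1 h1.symm z (Finset.mem_univ z)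
  have h3 := (Finset.sum_eq_zero_iff_of_nonneg fun b _ =>
    Finset.sum_nonneg fun z' _ => hnn z b z').1 h2 b (Finset.mem_univ b)
  by_contra hp
  simp only [f, hp, if_false, mul_one, ← Finset.mul_sum, M.P_sum] at h3
  exact mul_ne_zero (hμ0 z).ne' hb h3

/-- After `l` steps, of which the parameter `Y` knows nothing, the mean drift at `Y` is close to
its steady-state value: the bias is at most twice the total variation distance to stationarity
times the supremum of the drift. -/
theorem integral_tdDrift_le_of_tvDist_le [DecidableEq X] (htraj : IsTrajectory M π μ ℙ x a)
    (hrmax : 0 < rmax) (hφ : ∀ z, ‖φ z‖ ≤ 1) (hr : ∀ z b, π.prob z b ≠ 0 → |M.r z b| ≤ rmax)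
    {v : EuclideanSpace ℝ (Fin d)} (hv : ‖v‖ ≤ R) {k l : ℕ} {ε : ℝ}
    (hmix : ∀ z, tvDist (fun y => (transitionMatrix M π ^ l) z y) μ ≤ ε)
    {Y : Ω → EuclideanSpace ℝ (Fin d)} (hY : IsHistoryFun x a k Y) (hYR : ∀ ω, ‖Y ω‖ ≤ R) :
    ∫ ω, tdDrift M φ v (Y ω) (x (k + l) ω) (a (k + l) ω) (x (k + l + 1) ω) ∂ℙ ≤
      ∫ ω, steadyMean M π μ (tdDrift M φ v (Y ω)) ∂ℙ + 2 * ε * (rmax + 2 * R) ^ 2 := by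
  have hint : Integrable (fun ω => steadyMean M π μ (tdDrift M φ v (Y ω))) ℙ :=
    (hY.comp fun w => steadyMean M π μ (tdDrift M φ v w)).integrable htraj
  rw [integral_transition htraj l (hY.comp fun w => tdDrift M φ v w)]
  have h1 : ∫ ω, steadyMean M π μ (tdDrift M φ v (Y ω)) ∂ℙ + 2 * ε * (rmax + 2 * R) ^ 2 =
      ∫ ω, (steadyMean M π μ (tdDrift M φ v (Y ω)) + 2 * ε * (rmax + 2 * R) ^ 2) ∂ℙ := by
    rw [integral_add hint (integrable_const _)]; simp
  rw [h1]
  refine integral_mono (((isHistoryFun_state le_rfl).comp₂ hY fun z w =>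
    ∑ y, (transitionMatrix M π ^ l) z y * transitionMean M π (tdDrift M φ v w) y).integrable htraj)
    (hint.add (integrable_const _)) fun ω => ?_
  have h2 : ∑ y, (transitionMatrix M π ^ l) (x k ω) y *
      transitionMean M π (tdDrift M φ v (Y ω)) y - steadyMean M π μ (tdDrift M φ v (Y ω)) ≤
      ∑ y, |(transitionMatrix M π ^ l) (x k ω) y - μ y| * (rmax + 2 * R) ^ 2 := by
    rw [steadyMean_eq_sum_transitionMean, ← Finset.sum_sub_distrib]
    refine Finset.sum_le_sum fun y _ => ?_
    rw [← sub_mul]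
    refine (le_abs_self _).trans ?_
    rw [abs_mul]
    gcongr
    exact abs_transitionMean_le fun b z' hb => abs_tdDrift_le hrmax hφ z' (hr y b hb) hv (hYR ω)
  have h3 := hmix (x k ω)
  rw [tvDist] at h3
  rw [← Finset.sum_mul] at h2
  have h4 : (∑ y, |(transitionMatrix M π ^ l) (x k ω) y - μ y|) * (rmax + 2 * R) ^ 2 ≤
      2 * ε * (rmax + 2 * R) ^ 2 := by
    gcongr
    linarith
  linarith

theorem integrable_tdDrift (htraj : IsTrajectory M π μ ℙ x a) (φ : X → EuclideanSpace ℝ (Fin d))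
    (v : EuclideanSpace ℝ (Fin d)) {n : ℕ} {Z : Ω → EuclideanSpace ℝ (Fin d)}
    (hZ : IsHistoryFun x a n Z) :
    Integrable (fun ω => tdDrift M φ v (Z ω) (x n ω) (a n ω) (x (n + 1) ω)) ℙ :=
  ((((hZ.mono n.le_succ).comp₂ (isHistoryFun_state n.le_succ) fun w z => tdDrift M φ v w z).comp₂
    (isHistoryFun_action n.lt_succ_self) fun f b => f b).comp₂
    (isHistoryFun_state le_rfl) fun f z' => f z').integrable htraj

/-- The mean drift at a parameter `W` exceeds its steady-state value by little more than the mean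
drift at a nearby parameter `Y` does. -/
theorem integral_tdDrift_le_of_norm_sub_le [DecidableEq X] (htraj : IsTrajectory M π μ ℙ x a)
    (hμ0 : ∀ z, 0 ≤ μ z) (hμ1 : ∑ z, μ z = 1) (hrmax : 0 < rmax) (hφ : ∀ z, ‖φ z‖ ≤ 1)
    (hr : ∀ z b, π.prob z b ≠ 0 → |M.r z b| ≤ rmax) {n : ℕ}
    (hra : ∀ᵐ ω ∂ℙ, |M.r (x n ω) (a n ω)| ≤ rmax)
    {v : EuclideanSpace ℝ (Fin d)} (hv : ‖v‖ ≤ R) {Y W : Ω → EuclideanSpace ℝ (Fin d)}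
    (hY : IsHistoryFun x a n Y) (hYR : ∀ ω, ‖Y ω‖ ≤ R) (hW : IsHistoryFun x a n W)
    (hWR : ∀ ω, ‖W ω‖ ≤ R) {δ e : ℝ} (hWY : ∀ᵐ ω ∂ℙ, ‖W ω - Y ω‖ ≤ δ)
    (he : ∫ ω, tdDrift M φ v (Y ω) (x n ω) (a n ω) (x (n + 1) ω) ∂ℙ ≤
      ∫ ω, steadyMean M π μ (tdDrift M φ v (Y ω)) ∂ℙ + e) :
    ∫ ω, tdDrift M φ v (W ω) (x n ω) (a n ω) (x (n + 1) ω) ∂ℙ ≤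
      ∫ ω, steadyMean M π μ (tdDrift M φ v (W ω)) ∂ℙ + (e + 6 * (rmax + 2 * R) * δ) := by
  have hG : 0 ≤ rmax + 2 * R := by linarith [(norm_nonneg v).trans hv]
  have hint : ∀ {Z : Ω → EuclideanSpace ℝ (Fin d)}, IsHistoryFun x a n Z →
      Integrable (fun ω => steadyMean M π μ (tdDrift M φ v (Z ω))) ℙ := fun hZ =>
    (hZ.comp fun w => steadyMean M π μ (tdDrift M φ v w)).integrable htraj
  have hint' := fun {Z : Ω → EuclideanSpace ℝ (Fin d)} (hZ : IsHistoryFun x a n Z) =>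
    integrable_tdDrift htraj φ v hZ
  have h1 : ∫ ω, tdDrift M φ v (W ω) (x n ω) (a n ω) (x (n + 1) ω) ∂ℙ ≤
      ∫ ω, tdDrift M φ v (Y ω) (x n ω) (a n ω) (x (n + 1) ω) ∂ℙ + 3 * (rmax + 2 * R) * δ := by
    have h2 : ∫ ω, (tdDrift M φ v (Y ω) (x n ω) (a n ω) (x (n + 1) ω) +
        3 * (rmax + 2 * R) * δ) ∂ℙ =
        ∫ ω, tdDrift M φ v (Y ω) (x n ω) (a n ω) (x (n + 1) ω) ∂ℙ + 3 * (rmax + 2 * R) * δ := by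
      rw [integral_add (hint' hY) (integrable_const _)]; simp
    rw [← h2]
    refine integral_mono_ae (hint' hW) ((hint' hY).add (integrable_const _)) ?_
    filter_upwards [hra, hWY] with ω h3 h4
    have h5 := (abs_le.1 (abs_tdDrift_sub_le hrmax hφ (x (n + 1) ω) h3 hv (hWR ω) (hYR ω))).2
    have h6 : 3 * (rmax + 2 * R) * ‖W ω - Y ω‖ ≤ 3 * (rmax + 2 * R) * δ := by gcongr
    linarith
  have h2 : ∫ ω, steadyMean M π μ (tdDrift M φ v (Y ω)) ∂ℙ ≤
      ∫ ω, steadyMean M π μ (tdDrift M φ v (W ω)) ∂ℙ + 3 * (rmax + 2 * R) * δ := by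
    have h2 : ∫ ω, (steadyMean M π μ (tdDrift M φ v (W ω)) + 3 * (rmax + 2 * R) * δ) ∂ℙ =
        ∫ ω, steadyMean M π μ (tdDrift M φ v (W ω)) ∂ℙ + 3 * (rmax + 2 * R) * δ := by
      rw [integral_add (hint hW) (integrable_const _)]; simp
    rw [← h2]
    refine integral_mono_ae (hint hY) ((hint hW).add (integrable_const _)) ?_
    filter_upwards [hWY] with ω h4
    have h5 := steadyMean_tdDrift_le_add (M := M) (π := π) hμ0 hμ1 hrmax hφ hr hv (hWR ω) (hYR ω)
    have h6 : 3 * (rmax + 2 * R) * ‖W ω - Y ω‖ ≤ 3 * (rmax + 2 * R) * δ := by gcongr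
    linarith
  linarith

/-- The one-step recursion for the mean squared error: contraction at the rate of the steady
state, a bias `e` of the mean drift, and terms of order `α ^ 2` governed by an a priori bound `E`
of the error. -/
theorem integral_norm_sq_step_le [DecidableEq X] (htraj : IsTrajectory M π μ ℙ x a)
    (hμ0 : ∀ z, 0 ≤ μ z) (hμ : Matrix.vecMul μ (transitionMatrix M π) = μ)
    (hφ : ∀ z, ‖φ z‖ ≤ 1) {v : EuclideanSpace ℝ (Fin d)} (hv : ‖v‖ ≤ R)
    (hsol : IsTDSolution M π μ φ v)
    (hlam0 : 0 ≤ lambdaMin μ φ)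
    (hlam : ∀ w, lambdaMin μ φ * ‖w‖ ^ 2 ≤ ∑ z, μ z * (inner ℝ (φ z) w) ^ 2)
    {α : ℝ} (hα : 0 < α) (w₁ : EuclideanSpace ℝ (Fin d)) {n : ℕ} {e D E : ℝ}
    (hD : ∀ᵐ ω ∂ℙ, |tdError M φ (x n ω) (a n ω) (x (n + 1) ω)
      (projImplicitTD0 M φ α R w₁ (fun n => x n ω) (fun n => a n ω) n)| ≤ D)
    (hE : ∀ ω, ‖projImplicitTD0 M φ α R w₁ (fun n => x n ω) (fun n => a n ω) n - v‖ ≤ E)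
    (he : ∫ ω, tdDrift M φ v (projImplicitTD0 M φ α R w₁ (fun n => x n ω) (fun n => a n ω) n)
        (x n ω) (a n ω) (x (n + 1) ω) ∂ℙ ≤
      ∫ ω, steadyMean M π μ (tdDrift M φ v
        (projImplicitTD0 M φ α R w₁ (fun n => x n ω) (fun n => a n ω) n)) ∂ℙ + e) :
    ∫ ω, ‖projImplicitTD0 M φ α R w₁ (fun n => x n ω) (fun n => a n ω) (n + 1) - v‖ ^ 2 ∂ℙ ≤
      (1 - 2 * α * ((1 - M.γ) * lambdaMin μ φ) / (1 + α)) *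
        ∫ ω, ‖projImplicitTD0 M φ α R w₁ (fun n => x n ω) (fun n => a n ω) n - v‖ ^ 2 ∂ℙ +
      (2 * α * e + α ^ 2 * (D ^ 2 + 2 * D * E)) := by
  have hH := isHistoryFun_projImplicitTD0 M φ α R w₁ x a n
  have hH' := isHistoryFun_projImplicitTD0 M φ α R w₁ x a (n + 1)
  set W : Ω → EuclideanSpace ℝ (Fin d) := fun ω =>
    projImplicitTD0 M φ α R w₁ (fun n => x n ω) (fun n => a n ω) n with hW
  set c := (1 - M.γ) * lambdaMin μ φ with hc
  have hintV : Integrable (fun ω => ‖W ω - v‖ ^ 2) ℙ :=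
    (hH.comp fun w => ‖w - v‖ ^ 2).integrable htraj
  have hintT : Integrable (fun ω => tdDrift M φ v (W ω) (x n ω) (a n ω) (x (n + 1) ω)) ℙ :=
    integrable_tdDrift htraj φ v hH
  have h1 : ∫ ω, ‖projImplicitTD0 M φ α R w₁ (fun n => x n ω) (fun n => a n ω) (n + 1) - v‖ ^ 2 ∂ℙ
      ≤ ∫ ω, (‖W ω - v‖ ^ 2 + 2 * α * tdDrift M φ v (W ω) (x n ω) (a n ω) (x (n + 1) ω) +
        α ^ 2 * (D ^ 2 + 2 * D * E)) ∂ℙ := by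
    refine integral_mono_ae ((hH'.comp fun w => ‖w - v‖ ^ 2).integrable htraj)
      ((hintV.add (hintT.const_mul _)).add (integrable_const _)) ?_
    filter_upwards [hD] with ω h2
    have h3 := norm_projBall_implicitStep_sub_sq_le (M := M) hα hφ (x n ω) (a n ω) (x (n + 1) ω) hv
      (W ω)
    refine h3.trans ?_
    have h4 := hE ω
    have h5 : 0 ≤ D := (abs_nonneg _).trans h2
    gcongr
  have h2 : ∫ ω, (‖W ω - v‖ ^ 2 + 2 * α * tdDrift M φ v (W ω) (x n ω) (a n ω) (x (n + 1) ω) +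
        α ^ 2 * (D ^ 2 + 2 * D * E)) ∂ℙ = ∫ ω, ‖W ω - v‖ ^ 2 ∂ℙ +
      2 * α * ∫ ω, tdDrift M φ v (W ω) (x n ω) (a n ω) (x (n + 1) ω) ∂ℙ +
        α ^ 2 * (D ^ 2 + 2 * D * E) := by
    have h3 : Integrable (fun ω => ‖W ω - v‖ ^ 2 +
        2 * α * tdDrift M φ v (W ω) (x n ω) (a n ω) (x (n + 1) ω)) ℙ :=
      hintV.add (hintT.const_mul _)
    rw [integral_add h3 (integrable_const _), integral_add hintV (hintT.const_mul _), integral_const_mul]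
    simp
  have h3 : ∫ ω, steadyMean M π μ (tdDrift M φ v (W ω)) ∂ℙ ≤ -c * ∫ ω, ‖W ω - v‖ ^ 2 ∂ℙ := by
    rw [← integral_const_mul]
    refine integral_mono ((hH.comp fun w => steadyMean M π μ (tdDrift M φ v w)).integrable htraj)
      (hintV.const_mul _) fun ω => (steadyMean_tdDrift_le hμ0 hμ hsol (W ω)).trans ?_
    have h4 := mul_le_mul_of_nonneg_left (hlam (W ω - v)) (sub_pos.2 M.γ_lt_one).le
    rw [hc]
    linarith
  have hV0 : 0 ≤ ∫ ω, ‖W ω - v‖ ^ 2 ∂ℙ := integral_nonneg fun ω => sq_nonneg _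
  have hc0 : 0 ≤ c := mul_nonneg (sub_pos.2 M.γ_lt_one).le hlam0
  have h4 : 2 * α * c / (1 + α) ≤ 2 * α * c := div_le_self (by positivity) (by linarith)
  have h5 := mul_le_mul_of_nonneg_right h4 hV0
  have h6 := mul_le_mul_of_nonneg_left (he.trans (add_le_add_left h3 e)) (by positivity : 0 ≤ 2 * α)
  rw [h2] at h1
  linarith

end MeanDrift

/-! ### The finite-time bound -/

section FiniteTime

theorem tvDist_pow_mixingTime_le {X : Type*} [Fintype X] [DecidableEq X]
    {T : Matrix X X ℝ} {μ : X → ℝ} {m ρ α : ℝ} (h : MixesGeometrically T μ m ρ)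
    (hα : 0 < α) (z : X) : tvDist (fun y => (T ^ mixingTime m ρ α) z y) μ ≤ α := by
  have hne : {n : ℕ | m * ρ ^ n ≤ α}.Nonempty := by
    obtain ⟨n, hn⟩ := exists_pow_lt_of_lt_one (div_pos hα h.m_pos) h.ρ_lt_one
    exact ⟨n, by rw [lt_div_iff₀ h.m_pos, mul_comm] at hn; exact hn.le⟩
  exact (h.bound _ z).trans (Nat.sInf_mem hne)

variable {X A : Type*} [Fintype X] [DecidableEq X] [Fintype A] {d : ℕ} {M : FiniteMDP X A}
  {π : Policy X A} {μ : X → ℝ} {φ : X → EuclideanSpace ℝ (Fin d)} {rmax R : ℝ}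
  [MeasurableSpace X] [DiscreteMeasurableSpace X] [MeasurableSpace A]
  [DiscreteMeasurableSpace A] {Ω : Type*} [MeasurableSpace Ω] {ℙ : Measure Ω}
  [IsProbabilityMeasure ℙ] {x : ℕ → Ω → X} {a : ℕ → Ω → A}

/-- The finite-time bound with the factor `(1 - 2 α c / (1 + α)) ^ N`, where `c = (1 - γ) λ_min`,
in place of the exponential, and with any `τ` after which the chain is `α`-mixed. -/
theorem integral_norm_sq_projImplicitTD0_le (htraj : IsTrajectory M π μ ℙ x a)
    (hμ0 : ∀ z, 0 < μ z) (hμ1 : ∑ z, μ z = 1) (hμ : Matrix.vecMul μ (transitionMatrix M π) = μ)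
    (hrmax : 0 < rmax) (hφ : ∀ z, ‖φ z‖ ≤ 1) (hr : ∀ z b, π.prob z b ≠ 0 → |M.r z b| ≤ rmax)
    (hra : ∀ n, ∀ᵐ ω ∂ℙ, |M.r (x n ω) (a n ω)| ≤ rmax) (hd : 0 < d)
    (hrank : (featureMatrix φ).rank = d) {v : EuclideanSpace ℝ (Fin d)} (hv : ‖v‖ ≤ R)
    (hsol : IsTDSolution M π μ φ v) {α : ℝ} (hα : 0 < α)
    (hstep : 2 * α * ((1 - M.γ) * lambdaMin μ φ) < 1 + α) {τ : ℕ}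
    (hτ : ∀ z, tvDist (fun y => (transitionMatrix M π ^ τ) z y) μ ≤ α)
    (w₁ : EuclideanSpace ℝ (Fin d)) (N : ℕ) :
    ∫ ω, ‖projImplicitTD0 M φ α R w₁ (fun n => x n ω) (fun n => a n ω) N - v‖ ^ 2 ∂ℙ ≤
      (1 - 2 * α * ((1 - M.γ) * lambdaMin μ φ) / (1 + α)) ^ N * ‖w₁ - v‖ ^ 2 +
        α * (1 + α) * (rmax + 2 * R) ^ 2 * (9 + 12 * τ) /
          (2 * ((1 - M.γ) * lambdaMin μ φ)) := by
  obtain ⟨hlam0, hlam⟩ := lambdaMin_pos_and_mul_norm_sq_le hd hμ0 hrank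
  have hlam1 := lambdaMin_le_one hμ0 hμ1 hrank hφ
  have hμ0' := fun z => (hμ0 z).le
  have hR : 0 ≤ R := (norm_nonneg v).trans hv
  have hγ := sub_pos.2 M.γ_lt_one
  have hc : 0 < (1 - M.γ) * lambdaMin μ φ := mul_pos hγ hlam0
  have hc1 : (1 - M.γ) * lambdaMin μ φ ≤ 1 :=
    mul_le_one₀ (by linarith [M.γ_pos]) hlam0.le hlam1
  have hra' : ∀ᵐ ω ∂ℙ, ∀ n, |M.r (x n ω) (a n ω)| ≤ rmax := ae_all_iff.2 hra
  set W : ℕ → Ω → EuclideanSpace ℝ (Fin d) := fun n ω =>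
    projImplicitTD0 M φ α R w₁ (fun n => x n ω) (fun n => a n ω) n with hW
  have hWH : ∀ n, IsHistoryFun x a n (W n) := isHistoryFun_projImplicitTD0 M φ α R w₁ x a
  have hWR : ∀ n, 1 ≤ n → ∀ ω, ‖W n ω‖ ≤ R := fun n hn ω => norm_projImplicitTD0_le hR _ _ _ hn
  have hWv : ∀ n, 1 ≤ n → ∀ ω, ‖W n ω - v‖ ≤ rmax + 2 * R := fun n hn ω => by
    linarith [norm_sub_le (W n ω) v, hWR n hn ω]
  have hconst : ∀ (n : ℕ) (w : EuclideanSpace ℝ (Fin d)),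
      ∫ ω, tdDrift M φ v w (x n ω) (a n ω) (x (n + 1) ω) ∂ℙ ≤
        ∫ _, steadyMean M π μ (tdDrift M φ v w) ∂ℙ + 0 := fun n w => by
    rw [integral_transition_eq_steadyMean htraj hμ n (tdDrift M φ v w)]
    simp
  -- the step inequality for iterates inside the ball
  have hgen : ∀ n, 1 ≤ n → ∀ e, ∫ ω, tdDrift M φ v (W n ω) (x n ω) (a n ω) (x (n + 1) ω) ∂ℙ ≤
      ∫ ω, steadyMean M π μ (tdDrift M φ v (W n ω)) ∂ℙ + e →
      ∫ ω, ‖W (n + 1) ω - v‖ ^ 2 ∂ℙ ≤ (1 - 2 * α * ((1 - M.γ) * lambdaMin μ φ) / (1 + α)) *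
        ∫ ω, ‖W n ω - v‖ ^ 2 ∂ℙ + (2 * α * e + α ^ 2 * (3 * (rmax + 2 * R) ^ 2)) := by
    intro n hn e he
    have h1 := integral_norm_sq_step_le (D := rmax + 2 * R) (E := rmax + 2 * R) htraj hμ0' hμ hφ
      hv hsol hlam0.le hlam hα w₁ (n := n) ?_ (hWv n hn) he
    · refine h1.trans_eq ?_
      ring
    · filter_upwards [hra n] with ω h2
      refine (abs_tdError_le hφ _ h2 _).trans ?_
      linarith [hWR n hn ω]
  refine le_of_recursion (V := fun n => ∫ ω, ‖W n ω - v‖ ^ 2 ∂ℙ) (G := rmax + 2 * R) (τ := τ) hα hc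
    hc1 (by positivity) hstep rfl rfl ?_ ?_ ?_ ?_ ?_ N
  · simp [hW, projImplicitTD0]
  · intro n hn
    have h1 : ∫ ω, ‖W n ω - v‖ ^ 2 ∂ℙ ≤ ∫ _, (rmax + 2 * R) ^ 2 ∂ℙ := by
      refine integral_mono (((hWH n).comp fun w => ‖w - v‖ ^ 2).integrable htraj)
        (integrable_const _) fun ω => ?_
      have := hWv n hn ω
      gcongr
    simpa using h1
  · have h1 := integral_norm_sq_step_le (D := rmax + 2 * R + 2 * ‖w₁ - v‖) (E := ‖w₁ - v‖) htraj
      hμ0' hμ hφ hv hsol hlam0.le hlam hα w₁ (n := 0) ?_ (fun ω => le_rfl) (hconst 0 w₁)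
    · refine h1.trans_eq ?_
      ring
    · filter_upwards [hra 0] with ω h2
      refine (abs_tdError_le hφ _ h2 _).trans ?_
      have := norm_le_norm_sub_add w₁ v
      change rmax + 2 * ‖w₁‖ ≤ _
      linarith
  · intro n hn
    have h1 := integral_tdDrift_le_of_norm_sub_le htraj hμ0' hμ1 hrmax hφ hr (hra (n + 1)) hv
      (Y := fun _ => projBall R w₁) (fun _ _ _ _ => rfl) (fun _ => norm_projBall_le hR w₁)
      (hWH (n + 1)) (hWR (n + 1) (by omega))
      (δ := α * (rmax + 2 * R + 2 * ‖w₁ - v‖) + n * (α * (rmax + 2 * R))) (e := 0) ?_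
      (hconst (n + 1) (projBall R w₁))
    · refine (hgen (n + 1) (by omega) _ h1).trans_eq ?_
      ring
    · filter_upwards [hra'] with ω h2
      have h3 := norm_projImplicitTD0_one_sub_le (φ := φ) hα hφ hv w₁ h2
      have h4 := norm_projImplicitTD0_add_sub_le (φ := φ) hα hR hφ w₁ h2 le_rfl n
      rw [add_comm 1 n] at h4
      have h5 := norm_sub_le_norm_sub_add_norm_sub (W (n + 1) ω) (W 1 ω) (projBall R w₁)
      simp only [hW] at h5 ⊢
      linarith
  · intro n hn
    obtain ⟨k, rfl⟩ := Nat.exists_eq_add_of_le' (Nat.le_of_succ_le hn)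
    have hk : 1 ≤ k := by omega
    have h1 := integral_tdDrift_le_of_norm_sub_le htraj hμ0' hμ1 hrmax hφ hr (hra (k + τ)) hv
      ((hWH k).mono (Nat.le_add_right k τ)) (hWR k hk) (hWH (k + τ)) (hWR (k + τ) (by omega))
      (δ := τ * (α * (rmax + 2 * R))) ?_
      (integral_tdDrift_le_of_tvDist_le htraj hrmax hφ hr hv hτ (hWH k) (hWR k hk))
    · refine (hgen (k + τ) (by omega) _ h1).trans_eq ?_
      ring
    · filter_upwards [hra'] with ω h2
      exact norm_projImplicitTD0_add_sub_le (φ := φ) hα hR hφ w₁ h2 hk τ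

end FiniteTime

end ImplicitTD

theorem theorem2 {X A : Type*} [Fintype X] [DecidableEq X] [Fintype A]
    [MeasurableSpace X] [DiscreteMeasurableSpace X]
    [MeasurableSpace A] [DiscreteMeasurableSpace A]
    {Ω : Type*} [MeasurableSpace Ω] (ℙ : Measure Ω) [IsProbabilityMeasure ℙ]
    {d : ℕ} (M : FiniteMDP X A) (π : Policy X A) (φ : X → EuclideanSpace ℝ (Fin d))
    (μ : X → ℝ) (x : ℕ → Ω → X) (a : ℕ → Ω → A) (rmax : ℝ)
    -- the chain is irreducible and aperiodic with unique, positive steady-state distribution `μ`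
    (hchain : IsErgodicChain (transitionMatrix M π) μ)
    -- the data are a stationary trajectory under the policy
    (htraj : IsTrajectory M π μ ℙ x a)
    -- bounded rewards
    (hrmax : 0 < rmax) (hr : ∀ n, ∀ᵐ ω ∂ℙ, |M.r (x n ω) (a n ω)| ≤ rmax)
    -- normalized features
    (hφ : ∀ n, ∀ᵐ ω ∂ℙ, ‖φ (x n ω)‖ ≤ 1)
    -- full column rank
    (hrank : (featureMatrix φ).rank = d) :
    -- the mixing constants and the limit point exist
    (∃ m ρ : ℝ, MixesGeometrically (transitionMatrix M π) μ m ρ) ∧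
    (∃! wstar : EuclideanSpace ℝ (Fin d), IsTDSolution M π μ φ wstar) ∧
    -- the finite-time bound
    (∀ (m ρ : ℝ), MixesGeometrically (transitionMatrix M π) μ m ρ →
      ∀ wstar : EuclideanSpace ℝ (Fin d), IsTDSolution M π μ φ wstar →
      ∀ α : ℝ, 0 < α → 2 * α * (1 - M.γ) * lambdaMin μ φ < 1 + α →
      ∀ R : ℝ, ‖wstar‖ ≤ R →
      ∀ (w₁ : EuclideanSpace ℝ (Fin d)) (N : ℕ),
        Integrable (fun ω => ‖projImplicitTD0 M φ α R w₁ (fun n => x n ω) (fun n => a n ω) N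
          - wstar‖ ^ 2) ℙ ∧
        ∫ ω, ‖projImplicitTD0 M φ α R w₁ (fun n => x n ω) (fun n => a n ω) N - wstar‖ ^ 2 ∂ℙ
          ≤ Real.exp (-(2 * α * (1 - M.γ) * lambdaMin μ φ / (1 + α)) * N) * ‖w₁ - wstar‖ ^ 2
            + α * (1 + α) * (rmax + 2 * R) ^ 2 * (9 + 12 * (mixingTime m ρ α : ℝ))
              / (2 * (1 - M.γ) * lambdaMin μ φ)) ∧
    -- for `γ ≥ 1/2` the step-size condition holds for every step size
    (1 / 2 ≤ M.γ → ∀ α : ℝ, 0 < α → 2 * α * (1 - M.γ) * lambdaMin μ φ < 1 + α) := by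
  have hμ0 := hchain.pos
  have hμ1 := hchain.stationary.sum_eq_one
  have hμ := hchain.stationary.invariant
  have hr' := forall_of_ae_initial htraj hμ0 hμ (p := fun z b => |M.r z b| ≤ rmax) (hr 0)
  have hφ' : ∀ z, ‖φ z‖ ≤ 1 := fun z => by
    obtain ⟨b, -, hb⟩ := Finset.exists_ne_zero_of_sum_ne_zero
      (by rw [π.prob_sum z]; exact one_ne_zero : ∑ b, π.prob z b ≠ 0)
    exact forall_of_ae_initial htraj hμ0 hμ (p := fun z _ => ‖φ z‖ ≤ 1) (hφ 0) z b hb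
  refine ⟨exists_mixesGeometrically (transitionMatrix_mem_rowStochastic M π) hchain,
    existsUnique_isTDSolution hμ0 hμ hrank, ?_, ?_⟩
  · intro m ρ hmix v hsol α hα hstep R hv w₁ N
    refine ⟨((isHistoryFun_projImplicitTD0 M φ α R w₁ x a N).comp
      fun w => ‖w - v‖ ^ 2).integrable htraj, ?_⟩
    rcases Nat.eq_zero_or_pos d with rfl | hd
    · simp [Subsingleton.elim _ v, lambdaMin_eq_zero_of_dim_zero]
    have hstep' : 2 * α * ((1 - M.γ) * lambdaMin μ φ) < 1 + α := by rwa [← mul_assoc]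
    refine (integral_norm_sq_projImplicitTD0_le htraj hμ0 hμ1 hμ hrmax hφ' hr' hr hd hrank hv hsol
      hα hstep' (tvDist_pow_mixingTime_le hmix hα) w₁ N).trans ?_
    simp only [← mul_assoc]
    gcongr
    set q := 2 * α * (1 - M.γ) * lambdaMin μ φ / (1 + α) with hq
    have hq1 : q ≤ 1 := (div_le_one (by linarith)).2 hstep.le
    rw [mul_comm (-q), Real.exp_nat_mul]
    exact pow_le_pow_left₀ (by linarith) (Real.one_sub_le_exp_neg q) N
  · intro hγ α hα
    have h1 := lambdaMin_le_one hμ0 hμ1 hrank hφ'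
    have h2 := mul_le_mul_of_nonneg_left h1
      (mul_nonneg (by positivity : 0 ≤ 2 * α) (sub_pos.2 M.γ_lt_one).le)
    have h3 := mul_le_mul_of_nonneg_left hγ hα.le
    linarith
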